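/- Let $g:[0,\infty)\to\mathbb{R}$, $G(s)=\int_0^s g$ and $\varepsilon_\omega=\sup_{0\le s\le 3\omega}|s\,g''(s)|$. For $\omega>0$ small, let $\phi_\omega$ be the unique nontrivial, nonnegative, even solution in $H^1(\mathbb{R})$ of $\phi''=\omega\phi-\phi^3+\phi\,g(\phi^2)$. Assume: $(H_1)$ $g\in C^5((0,\infty))\cap C^1([0,\infty))$, $g^{(k)}(s)=o(s^{1-k})$ as $s\to0^+$ for every $k\in\{0,\dots,5\}$, and $g$ does not vanish identically near $0$; $(H_2)$ $\displaystyle \lim_{\omega\to0^+}\frac{1}{\varepsilon_\omega^2\sqrt{\omega}}\int_{\mathbb{R}}\Big(-3g(\phi_\omega^2)+\phi_\omega^2g'(\phi_\omega^2)+4\frac{G(\phi_\omega^2)}{\phi_\omega^2}\Big)\,dx=+\infty .$ Put $L_+=-\partial_x^2+\omega-3\phi_\omega^2+g(\phi_\omega^2)+2\phi_\omega^2g'(\phi_\omega^2)$ and $L_-=-\partial_x^2+\omega-\phi_\omega^2+g(\phi_\omega^2)$. Then there is $\omega_0>0$ (depending on $g$) such that for every $\omega\in(0,\omega_0)$ the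 following holds. Let $\lambda\in\mathbb{C}$ and let $X,Y:\mathbb{R}\to\mathbb{C}$ satisfy $X,Y\in L^\infty(\mathbb{R})$, $X',Y'\in H^1(\mathbb{R})$ and $$L_-X=\lambda Y,\qquad L_+Y=\lambda X$$ (such a triple $(X,Y,\lambda)$ is called a resonance). Then either $X=Y=0$, or $\lambda=0$, $X\in\mathrm{span}_{\mathbb{C}}(\phi_\omega)$ and $Y\in\mathrm{span}_{\mathbb{C}}(\phi_\omega')$. -/

import Mathlib

open MeasureTheory Filter Topology Set

namespace NLS

noncomputable section

/-- `f'` is the weak (distributional) derivative of `f` on the real line. -/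
structure HasWeakDeriv {E : Type*} [NormedAddCommGroup E] [NormedSpace ℝ E]
    (f f' : ℝ → E) : Prop where
  locallyIntegrable : LocallyIntegrable f volume
  locallyIntegrable_deriv : LocallyIntegrable f' volume
  integral_eq : ∀ ψ : ℝ → ℝ, ContDiff ℝ (⊤ : ℕ∞) ψ → HasCompactSupport ψ →
    ∫ x, deriv ψ x • f x = - ∫ x, ψ x • f' x

/-- The Sobolev space `H¹(ℝ)`. -/
def MemH1 {E : Type*} [NormedAddCommGroup E] [NormedSpace ℝ E] (f : ℝ → E) : Prop :=
  MemLp f 2 volume ∧ ∃ f' : ℝ → E, HasWeakDeriv f f' ∧ MemLp f' 2 volume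

/-- `φ` is a nontrivial, nonnegative, even solution in `H¹(ℝ)` of
`φ'' = ω φ - φ³ + φ g(φ²)`. Only the values of `g` on `[0, ∞)` matter. -/
structure IsSolitaryWave (g : ℝ → ℝ) (ω : ℝ) (φ : ℝ → ℝ) : Prop where
  contDiff : ContDiff ℝ 2 φ
  memH1 : MemH1 φ
  even : Function.Even φ
  nonneg : ∀ x, 0 ≤ φ x
  nontrivial : ∃ x, φ x ≠ 0
  equation : ∀ x, deriv (deriv φ) x = ω * φ x - φ x ^ 3 + φ x * g (φ x ^ 2)

open Classical in
/-- The solitary wave `φ_ω` (which is unique for `ω > 0` small); zero if there is none. -/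
def solitaryWave (g : ℝ → ℝ) (ω : ℝ) : ℝ → ℝ :=
  if h : ∃ φ, IsSolitaryWave g ω φ then h.choose else 0

/-- `G(s) = ∫₀ˢ g`. -/
def primitive (g : ℝ → ℝ) (s : ℝ) : ℝ := ∫ t in (0 : ℝ)..s, g t

/-- `ε_ω = sup_{0 ≤ s ≤ 3ω} |s g''(s)|` (the quantity is `0` at `s = 0`). -/
def smallness (g : ℝ → ℝ) (ω : ℝ) : ℝ :=
  sSup ((fun s : ℝ => |s * iteratedDeriv 2 g s|) '' Icc 0 (3 * ω))

/-- Hypothesis `(H₁)`: `g ∈ C⁵((0,∞)) ∩ C¹([0,∞))`, `g⁽ᵏ⁾(s) = o(s^{1-k})` as `s → 0⁺` for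
`0 ≤ k ≤ 5`, and `g` does not vanish identically near `0`. -/
structure HypothesisH1 (g : ℝ → ℝ) : Prop where
  contDiffOn_five : ContDiffOn ℝ 5 g (Ioi 0)
  contDiffOn_one : ContDiffOn ℝ 1 g (Ici 0)
  isLittleO : ∀ k : ℕ, k ≤ 5 →
    (fun s : ℝ => iteratedDeriv k g s) =o[𝓝[>] 0] (fun s : ℝ => s ^ (1 - (k : ℤ)))
  not_eventually_zero : ¬ ∀ᶠ s in 𝓝[≥] (0 : ℝ), g s = 0

/-- Hypothesis `(H₂)`: as `ω → 0⁺`,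
`(ε_ω² √ω)⁻¹ ∫ (-3 g(φ_ω²) + φ_ω² g'(φ_ω²) + 4 G(φ_ω²) / φ_ω²) → +∞`. -/
def HypothesisH2 (g : ℝ → ℝ) : Prop :=
  Tendsto (fun ω : ℝ => 1 / (smallness g ω ^ 2 * √ω) *
    ∫ x, (-3 * g (solitaryWave g ω x ^ 2)
      + solitaryWave g ω x ^ 2 * deriv g (solitaryWave g ω x ^ 2)
      + 4 * (primitive g (solitaryWave g ω x ^ 2) / solitaryWave g ω x ^ 2)))
    (𝓝[>] 0) atTop

/-- The potential of `L₊ = -∂ₓ² + ω - 3 φ_ω² + g(φ_ω²) + 2 φ_ω² g'(φ_ω²)`. -/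
def potentialPlus (g : ℝ → ℝ) (ω x : ℝ) : ℝ :=
  ω - 3 * solitaryWave g ω x ^ 2 + g (solitaryWave g ω x ^ 2)
    + 2 * solitaryWave g ω x ^ 2 * deriv g (solitaryWave g ω x ^ 2)

/-- The potential of `L₋ = -∂ₓ² + ω - φ_ω² + g(φ_ω²)`. -/
def potentialMinus (g : ℝ → ℝ) (ω x : ℝ) : ℝ :=
  ω - solitaryWave g ω x ^ 2 + g (solitaryWave g ω x ^ 2)

/-- `(-∂ₓ² + V) X = Z` almost everywhere, the derivatives of `X` being weak derivatives. -/
def SchrodingerEq (V : ℝ → ℝ) (X Z : ℝ → ℂ) : Prop :=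
  ∃ X₁ X₂ : ℝ → ℂ, HasWeakDeriv X X₁ ∧ HasWeakDeriv X₁ X₂ ∧
    ∀ᵐ x, - X₂ x + (V x : ℂ) * X x = Z x

/-- `(X, Y, lam)` solves the linearized system `L₋ X = lam Y`, `L₊ Y = lam X`, with
`X, Y ∈ L^∞` and `X', Y' ∈ H¹(ℝ)`. -/
structure IsResonance (g : ℝ → ℝ) (ω : ℝ) (X Y : ℝ → ℂ) (lam : ℂ) : Prop where
  memLp_left : MemLp X ⊤ volume
  memLp_right : MemLp Y ⊤ volume
  deriv_left : ∃ X₁ : ℝ → ℂ, HasWeakDeriv X X₁ ∧ MemH1 X₁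
  deriv_right : ∃ Y₁ : ℝ → ℂ, HasWeakDeriv Y Y₁ ∧ MemH1 Y₁
  eq_minus : SchrodingerEq (potentialMinus g ω) X (fun x => lam * Y x)
  eq_plus : SchrodingerEq (potentialPlus g ω) Y (fun x => lam * X x)

end

end NLS

/-! ### Weak derivatives, linear equations and monotone functions on the line -/

namespace NLS

/-! Let φ be the solitary wave, p = φ'/φ, n = φ''/φ and S = ∂ₓ - p, so that L₋ = S*S. Applying S² to
X and a companion operator to Y gives functions V, W with V'' = (6p² - 5n + 2l)V - λW and W'' = (2p²
- n)W - λV, where 2l is the difference of the potentials of L₊ and L₋. For g = 0 both new potentials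
equal ω: the transformation removes the cubic soliton. In general P = V + W and D = V - W solve a
free system perturbed by b = 4p² - 3n + l - ω and q = 2p² - 2n + l, both O(εφ²), and b is exactly
the integrand in (H₂).

The function b has no sign, but its integral is much larger than ε²√ω. Hence b = ι + β' with ι ≥
4000ε²φ² and |β| ≤ 20εφ (`IsNearCubic.repulsiveCoefficients`). Integrating β'P² by parts costs P'²
and O(ε²φ²P²), which ι absorbs, so b acts as a repulsive potential.

For 0 < λ ≤ ω an energy identity excludes bounded P, D (`RepulsiveCoefficients.eq_zero_of_le`). For
λ > ω the solution is square integrable and a virial identity excludes it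
(`RepulsiveCoefficients.eq_zero_of_lt`). Negative λ follow by changing the sign of X, and nonreal λ
from positivity of both potentials (`eq_zero_of_im_ne_zero`). In each case a functional F has F' ≥ 0
and is too small at infinity to be nonzero, so F' = 0. Thus V = 0, which forces X = Y = 0 when λ ≠ 0
(`eq_zero_of_transformedV_eq_zero`). For λ = 0 the equations decouple, and Wronskians with φ and φ'
identify the bounded solutions. -/

theorem contDiff_top_of_hasDerivAt {f f' : ℝ → ℝ} (h : ∀ x, HasDerivAt f (f' x) x)
    (hf' : ContDiff ℝ (⊤ : ℕ∞) f') : ContDiff ℝ (⊤ : ℕ∞) f := by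
  rw [contDiff_infty_iff_deriv]
  refine ⟨fun x => (h x).differentiableAt, ?_⟩
  rwa [show deriv f = f' from funext fun x => (h x).deriv]

theorem integral_Iic_eq_add {f : ℝ → ℝ} (hi : Integrable f) (x : ℝ) :
    ∫ t in Iic x, f t = (∫ t in Iic (0 : ℝ), f t) + ∫ t in (0 : ℝ)..x, f t := by
  rw [← intervalIntegral.integral_Iic_sub_Iic hi.integrableOn hi.integrableOn]
  ring

theorem hasDerivAt_integral_Iic {f : ℝ → ℝ} (hf : Continuous f) (hi : Integrable f) (x : ℝ) :
    HasDerivAt (fun y => ∫ t in Iic y, f t) (f x) x := by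
  have h1 := (intervalIntegral.integral_hasDerivAt_right (hf.intervalIntegrable 0 x)
    hf.stronglyMeasurable.stronglyMeasurableAtFilter hf.continuousAt).const_add
    (∫ t in Iic (0 : ℝ), f t)
  exact h1.congr_of_eventuallyEq (Eventually.of_forall (integral_Iic_eq_add hi))

/-- A smooth compactly supported function of mean zero is the derivative of such a function. -/
theorem exists_primitive_of_integral_eq_zero {σ : ℝ → ℝ} (hσ : ContDiff ℝ (⊤ : ℕ∞) σ)
    (hc : HasCompactSupport σ) (h0 : ∫ x, σ x = 0) :
    ∃ ψ : ℝ → ℝ, ContDiff ℝ (⊤ : ℕ∞) ψ ∧ HasCompactSupport ψ ∧ deriv ψ = σ := by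
  obtain ⟨R, hR⟩ := hc.isCompact.isBounded.subset_closedBall 0
  have hz : ∀ x, R < |x| → σ x = 0 := fun x hx => by
    by_contra h
    have := hR (subset_tsupport _ h)
    simp only [Metric.mem_closedBall, dist_zero_right, Real.norm_eq_abs] at this
    linarith
  have hint : Integrable σ := hσ.continuous.integrable_of_hasCompactSupport hc
  have hψ := hasDerivAt_integral_Iic hσ.continuous hint
  refine ⟨_, contDiff_top_of_hasDerivAt hψ hσ, ?_, funext fun x => (hψ x).deriv⟩
  refine HasCompactSupport.intro (isCompact_closedBall (0 : ℝ) R) fun x hx => ?_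
  simp only [Metric.mem_closedBall, dist_zero_right, Real.norm_eq_abs, not_le] at hx
  rcases lt_abs.1 hx with h | h
  · have h2 : ∫ t in Ioi x, σ t = 0 := setIntegral_eq_zero_of_forall_eq_zero fun t ht =>
      hz t (lt_abs.2 (Or.inl (h.trans ht)))
    have := intervalIntegral.integral_Iic_add_Ioi (b := x) hint.integrableOn hint.integrableOn
    linarith
  · exact setIntegral_eq_zero_of_forall_eq_zero fun t ht =>
      hz t (lt_abs.2 (Or.inr (by have : t ≤ x := ht; linarith)))

/-- The lemma of du Bois-Reymond. -/
theorem ae_eq_const_of_integral_deriv_smul_eq_zero {f : ℝ → ℝ} (hf : LocallyIntegrable f volume)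
    (h : ∀ ψ : ℝ → ℝ, ContDiff ℝ (⊤ : ℕ∞) ψ → HasCompactSupport ψ → ∫ x, deriv ψ x • f x = 0) :
    ∃ c : ℝ, ∀ᵐ x, f x = c := by
  let B : ContDiffBump (0 : ℝ) := ⟨1, 2, one_pos, one_lt_two⟩
  set ρ : ℝ → ℝ := B.normed volume with hρ
  have hρs : ContDiff ℝ (⊤ : ℕ∞) ρ := B.contDiff_normed
  have hρc : HasCompactSupport ρ := B.hasCompactSupport_normed
  have hρi : Integrable ρ := hρs.continuous.integrable_of_hasCompactSupport hρc
  refine ⟨∫ x, ρ x • f x, ?_⟩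
  refine ae_eq_of_integral_contDiff_smul_eq hf (locallyIntegrable_const _) fun θ hθ hθc => ?_
  have hθi : Integrable θ := hθ.continuous.integrable_of_hasCompactSupport hθc
  set a : ℝ := ∫ x, θ x with ha
  -- Since `ρ` has integral one, removing `a * ρ` from `θ` leaves mean zero, hence an admissible
  -- `deriv ψ`.
  obtain ⟨ψ, hψ, hψc, hd⟩ := exists_primitive_of_integral_eq_zero (σ := fun x => θ x - a * ρ x)
    (hθ.sub (contDiff_const.mul hρs)) (hθc.sub (hρc.mul_left)) (by
      rw [integral_sub hθi (hρi.const_mul a), integral_const_mul, B.integral_normed]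
      simp [ha])
  have h1 := h ψ hψ hψc
  rw [hd] at h1
  have i1 : Integrable (fun x => θ x • f x) :=
    hf.integrable_smul_left_of_hasCompactSupport hθ.continuous hθc
  have i2 : Integrable (fun x => ρ x • f x) :=
    hf.integrable_smul_left_of_hasCompactSupport hρs.continuous hρc
  have h2 : ∫ x, (θ x - a * ρ x) • f x = (∫ x, θ x • f x) - a * ∫ x, ρ x • f x := by
    rw [← integral_const_mul, ← integral_sub i1 (i2.const_mul a)]
    congr 1
    ext x
    simp only [smul_eq_mul]
    ring
  rw [h2] at h1
  simp only [smul_eq_mul] at h1 ⊢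
  rw [integral_mul_const]
  linarith

/-- Integration by parts for absolutely continuous functions on an interval reaching beyond the
support of `ψ`, so that the boundary terms vanish. -/
theorem integral_deriv_mul_primitive {f : ℝ → ℝ} (hf : LocallyIntegrable f volume)
    {ψ : ℝ → ℝ} (hψ : ContDiff ℝ (⊤ : ℕ∞) ψ) (hc : HasCompactSupport ψ) :
    ∫ x, deriv ψ x * ∫ t in (0 : ℝ)..x, f t = -∫ x, ψ x * f x := by
  obtain ⟨R, hR⟩ := hc.isCompact.isBounded.subset_closedBall 0
  have hR' : ∀ x, R < |x| → x ∉ tsupport ψ := fun x hx h => by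
    have := hR h
    simp only [Metric.mem_closedBall, dist_zero_right, Real.norm_eq_abs] at this
    linarith
  have hz : ∀ x, R < |x| → ψ x = 0 := fun x hx => image_eq_zero_of_notMem_tsupport (hR' x hx)
  have hz' : ∀ x, R < |x| → deriv ψ x = 0 := fun x hx => by
    by_contra h
    exact hR' x hx (support_deriv_subset h)
  set S : ℝ := |R| + 1 with hS
  have hRS : ∀ x, x ∉ Ioc (-S) S → R < |x| := fun x hx => by
    have : R < S := by rw [hS]; linarith [le_abs_self R]
    simp only [mem_Ioc, not_and_or, not_lt, not_le] at hx
    rcases hx with h | h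
    · exact lt_of_lt_of_le this (le_abs.2 (Or.inr (by linarith)))
    · exact this.trans (lt_abs.2 (Or.inl h))
  have hSpos : -S ≤ S := by have := abs_nonneg R; rw [hS]; linarith
  have hfi : ∀ a b, IntervalIntegrable f volume a b := fun a b =>
    (hf.integrableOn_isCompact isCompact_uIcc).intervalIntegrable
  set F : ℝ → ℝ := fun x => ∫ t in (0 : ℝ)..x, f t with hF
  have h0 : (0 : ℝ) ∈ uIcc (-S) S := by
    rw [uIcc_of_le hSpos]; constructor <;> linarith
  have hFac : AbsolutelyContinuousOnInterval F (-S) S :=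
    (hfi (-S) S).absolutelyContinuousOnInterval_intervalIntegral h0
  have hψac : AbsolutelyContinuousOnInterval ψ (-S) S :=
    (hψ.of_le (by exact_mod_cast le_top)).contDiffOn.absolutelyContinuousOnInterval
  have key := hψac.integral_mul_deriv_eq_deriv_mul hFac
  have e1 : ψ S = 0 := hz _ (by rw [abs_of_nonneg (by linarith)]; linarith [le_abs_self R])
  have e2 : ψ (-S) = 0 := hz _ (by
    rw [abs_neg, abs_of_nonneg (by linarith)]; linarith [le_abs_self R])
  rw [e1, e2, zero_mul, zero_mul, sub_zero, zero_sub] at key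
  have k1 : ∫ x in (-S)..S, ψ x * deriv F x = ∫ x in (-S)..S, ψ x * f x := by
    apply intervalIntegral.integral_congr_ae
    filter_upwards [(hfi (-S) S).ae_hasDerivAt_integral] with x hx hx'
    rw [(hx (uIoc_subset_uIcc hx') 0 h0).deriv]
  have full : ∀ u : ℝ → ℝ, (∀ x, R < |x| → u x = 0) → ∫ x in (-S)..S, u x = ∫ x, u x := by
    intro u hu
    rw [intervalIntegral.integral_of_le hSpos]
    exact setIntegral_eq_integral_of_forall_compl_eq_zero fun x hx => hu x (hRS x hx)
  rw [k1, full _ fun x hx => by rw [hz x hx, zero_mul],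
    full _ fun x hx => by rw [hz' x hx, zero_mul]] at key
  rw [key, neg_neg]

/-- The difference of `f` and the primitive of `f'` has zero weak derivative, so du Bois-Reymond
applies. -/
theorem HasWeakDeriv.ae_eq_primitive {f f' : ℝ → ℝ} (h : HasWeakDeriv f f') :
    ∃ c : ℝ, ∀ᵐ x, f x = c + ∫ t in (0 : ℝ)..x, f' t := by
  have hfi : ∀ a b, IntervalIntegrable f' volume a b := fun a b =>
    (h.locallyIntegrable_deriv.integrableOn_isCompact isCompact_uIcc).intervalIntegrable
  have hcont : Continuous fun x => ∫ t in (0 : ℝ)..x, f' t :=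
    intervalIntegral.continuous_primitive hfi 0
  have hloc := hcont.locallyIntegrable (μ := volume)
  obtain ⟨c, hc⟩ := ae_eq_const_of_integral_deriv_smul_eq_zero
    (h.locallyIntegrable.sub hloc) (fun ψ hψ hψc => by
      have hd : Continuous (deriv ψ) := hψ.continuous_deriv (by exact_mod_cast le_top)
      have i1 : Integrable (fun x => deriv ψ x • f x) :=
        h.locallyIntegrable.integrable_smul_left_of_hasCompactSupport hd hψc.deriv
      have i2 : Integrable (fun x => deriv ψ x • ∫ t in (0 : ℝ)..x, f' t) :=
        hloc.integrable_smul_left_of_hasCompactSupport hd hψc.deriv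
      simp only [Pi.sub_apply, smul_sub]
      rw [integral_sub i1 i2, h.integral_eq ψ hψ hψc]
      simp only [smul_eq_mul]
      rw [integral_deriv_mul_primitive h.locallyIntegrable_deriv hψ hψc]
      ring)
  refine ⟨c, ?_⟩
  filter_upwards [hc] with x hx
  simp only [Pi.sub_apply] at hx
  linarith

theorem HasWeakDeriv.clm_comp {E F : Type*} [NormedAddCommGroup E] [NormedSpace ℝ E]
    [CompleteSpace E] [NormedAddCommGroup F] [NormedSpace ℝ F] [CompleteSpace F]
    {f f' : ℝ → E} (h : HasWeakDeriv f f')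
    (L : E →L[ℝ] F) : HasWeakDeriv (fun x => L (f x)) (fun x => L (f' x)) := by
  have hl : ∀ u : ℝ → E, LocallyIntegrable u volume →
      LocallyIntegrable (fun x => L (u x)) volume := fun u hu x => by
    obtain ⟨s, hs, hi⟩ := hu x
    exact ⟨s, hs, L.integrable_comp hi⟩
  refine ⟨hl _ h.locallyIntegrable, hl _ h.locallyIntegrable_deriv, fun ψ hψ hψc => ?_⟩
  have hd : Continuous (deriv ψ) := hψ.continuous_deriv (by exact_mod_cast le_top)
  have := congrArg L (h.integral_eq ψ hψ hψc)
  rw [map_neg, ← L.integral_comp_comm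
      (h.locallyIntegrable.integrable_smul_left_of_hasCompactSupport hd hψc.deriv),
    ← L.integral_comp_comm (h.locallyIntegrable_deriv.integrable_smul_left_of_hasCompactSupport
      hψ.continuous hψc)] at this
  simpa only [map_smul] using this

theorem HasWeakDeriv.exists_continuous_real {f f' : ℝ → ℝ} (h : HasWeakDeriv f f') :
    ∃ u : ℝ → ℝ, Continuous u ∧ f =ᵐ[volume] u ∧
      ∀ w : ℝ → ℝ, Continuous w → f' =ᵐ[volume] w → ∀ x, HasDerivAt u (w x) x := by
  obtain ⟨c, hc⟩ := h.ae_eq_primitive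
  have hfi : ∀ a b, IntervalIntegrable f' volume a b := fun a b =>
    (h.locallyIntegrable_deriv.integrableOn_isCompact isCompact_uIcc).intervalIntegrable
  refine ⟨_, continuous_const.add (intervalIntegral.continuous_primitive hfi 0), hc, ?_⟩
  intro w hw hfw x
  have : (fun x => c + ∫ t in (0 : ℝ)..x, f' t) = fun x => c + ∫ t in (0 : ℝ)..x, w t := by
    ext x
    congr 1
    exact intervalIntegral.integral_congr_ae (hfw.mono fun _ h _ => h)
  change HasDerivAt (fun x => c + ∫ t in (0 : ℝ)..x, f' t) (w x) x
  rw [this]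
  exact (intervalIntegral.integral_hasDerivAt_right (hw.intervalIntegrable _ _)
    hw.stronglyMeasurable.stronglyMeasurableAtFilter hw.continuousAt).const_add c

/-- A weakly differentiable function has a continuous representative, which is differentiable
as soon as the weak derivative is continuous. -/
theorem HasWeakDeriv.exists_continuous {f f' : ℝ → ℂ} (h : HasWeakDeriv f f') :
    ∃ u : ℝ → ℂ, Continuous u ∧ f =ᵐ[volume] u ∧
      ∀ w : ℝ → ℂ, Continuous w → f' =ᵐ[volume] w → ∀ x, HasDerivAt u (w x) x := by
  obtain ⟨u, hu, hfu, hu'⟩ := (h.clm_comp Complex.reCLM).exists_continuous_real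
  obtain ⟨v, hv, hfv, hv'⟩ := (h.clm_comp Complex.imCLM).exists_continuous_real
  refine ⟨fun x => u x + v x * Complex.I, by fun_prop, ?_, fun w hw hfw x => ?_⟩
  · filter_upwards [hfu, hfv] with x h1 h2
    rw [← h1, ← h2]
    exact (Complex.re_add_im _).symm
  · have h1 := hu' (fun x => (w x).re) (by fun_prop)
      (hfw.mono fun x hx => by simp only [Complex.reCLM_apply, hx]) x
    have h2 := hv' (fun x => (w x).im) (by fun_prop)
      (hfw.mono fun x hx => by simp only [Complex.imCLM_apply, hx]) x
    have := h1.ofReal_comp.add (h2.ofReal_comp.mul_const Complex.I)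
    rwa [Complex.re_add_im] at this

theorem HasWeakDeriv.ae_unique {E : Type*} [NormedAddCommGroup E] [NormedSpace ℝ E]
    [CompleteSpace E] {f f₁ f₂ : ℝ → E}
    (h₁ : HasWeakDeriv f f₁) (h₂ : HasWeakDeriv f f₂) : f₁ =ᵐ[volume] f₂ :=
  ae_eq_of_integral_contDiff_smul_eq h₁.locallyIntegrable_deriv h₂.locallyIntegrable_deriv
    fun ψ hψ hψc => by
      have := (h₁.integral_eq ψ hψ hψc).symm.trans (h₂.integral_eq ψ hψ hψc)
      exact neg_injective this

theorem HasWeakDeriv.congr_ae {E : Type*} [NormedAddCommGroup E] [NormedSpace ℝ E]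
    {f f' u : ℝ → E} (h : HasWeakDeriv f f') (hu : f =ᵐ[volume] u) : HasWeakDeriv u f' := by
  refine ⟨?_, h.locallyIntegrable_deriv, fun ψ hψ hψc => ?_⟩
  · intro x
    obtain ⟨s, hs, hi⟩ := h.locallyIntegrable x
    exact ⟨s, hs, hi.congr (ae_restrict_of_ae hu)⟩
  · rw [← h.integral_eq ψ hψ hψc]
    exact integral_congr_ae (hu.mono fun x hx => by simp only [hx])

/-- The weak derivative of a continuously differentiable function is its derivative. -/
theorem HasWeakDeriv.ae_eq_of_hasDerivAt {f f' w : ℝ → ℝ} (h : HasWeakDeriv f f')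
    (hw : ∀ x, HasDerivAt f (w x) x) (hc : Continuous w) : f' =ᵐ[volume] w := by
  refine h.ae_unique ⟨h.locallyIntegrable, hc.locallyIntegrable, fun ψ hψ hψc => ?_⟩
  have hd : Continuous (deriv ψ) := hψ.continuous_deriv (by exact_mod_cast le_top)
  have hψd : ∀ x, HasDerivAt ψ (deriv ψ x) x := fun x =>
    (hψ.differentiable (by simp)).differentiableAt.hasDerivAt
  have hfc : Continuous f := continuous_iff_continuousAt.2 fun x => (hw x).continuousAt
  have := integral_mul_deriv_eq_deriv_mul_of_integrable (u := f) (v := ψ) (u' := w)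
    (v' := deriv ψ) (fun x _ => hw x) (fun x _ => hψd x)
    ((hfc.mul hd).integrable_of_hasCompactSupport hψc.deriv.mul_left)
    ((hc.mul hψ.continuous).integrable_of_hasCompactSupport hψc.mul_left)
    ((hfc.mul hψ.continuous).integrable_of_hasCompactSupport hψc.mul_left)
  simp only [smul_eq_mul]
  simpa only [mul_comm] using this

/-- Uniqueness for the Cauchy problem of `u'' = q u`. -/
theorem eq_zero_of_linear_ode {𝕜 : Type*} [RCLike 𝕜] {q u u₁ : ℝ → 𝕜} (hq : Continuous q)
    (hu : ∀ x, HasDerivAt u (u₁ x) x) (hu₁ : ∀ x, HasDerivAt u₁ (q x * u x) x) {x₀ : ℝ}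
    (h0 : u x₀ = 0) (h1 : u₁ x₀ = 0) (x : ℝ) : u x = 0 := by
  set R : ℝ := |x| + |x₀| + 1
  obtain ⟨K, hK⟩ := (isCompact_Icc (a := -R) (b := R)).exists_bound_of_continuousOn
    hq.continuousOn
  have hx : x ∈ Ioo (-R) R := by
    constructor <;> simp only [R] <;> linarith [neg_abs_le x, le_abs_self x, abs_nonneg x₀]
  have hx₀ : x₀ ∈ Ioo (-R) R := by
    constructor <;> simp only [R] <;> linarith [neg_abs_le x₀, le_abs_self x₀, abs_nonneg x]
  have hK0 : 0 ≤ K := (norm_nonneg _).trans (hK x ⟨hx.1.le, hx.2.le⟩)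
  have key : EqOn (fun x => ((u x, u₁ x) : 𝕜 × 𝕜)) (fun _ => 0) (Ioo (-R) R) := by
    refine ODE_solution_unique_of_mem_Ioo (K := (1 + ⟨K, hK0⟩ : NNReal)) (s := fun _ => univ)
      (v := fun t (z : 𝕜 × 𝕜) => (z.2, q t * z.1)) (t₀ := x₀) ?_ hx₀ ?_ ?_ ?_
    · intro t ht
      refine (LipschitzWith.of_dist_le_mul fun z w => ?_).lipschitzOnWith
      rw [Prod.dist_eq, dist_eq_norm, dist_eq_norm, ← mul_sub, norm_mul]
      have h1 : ‖z.1 - w.1‖ ≤ dist z w := by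
        rw [← dist_eq_norm]; exact le_max_left _ _
      have h2 : ‖z.2 - w.2‖ ≤ dist z w := by
        rw [← dist_eq_norm]; exact le_max_right _ _
      have h3 : ‖q t‖ ≤ K := hK t ⟨ht.1.le, ht.2.le⟩
      have hd : 0 ≤ dist z w := dist_nonneg
      change max _ _ ≤ (1 + K) * dist z w
      refine max_le (by nlinarith) ?_
      calc ‖q t‖ * ‖z.1 - w.1‖ ≤ K * dist z w := by gcongr
        _ ≤ _ := by nlinarith
    · exact fun t _ => ⟨(hu t).prodMk (hu₁ t), mem_univ _⟩
    · intro t _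
      refine ⟨?_, mem_univ _⟩
      convert hasDerivAt_const t (0 : 𝕜 × 𝕜) using 1
      simp
    · simp [h0, h1]
  exact congrArg Prod.fst (key hx)

/-- A monotone function that is small on average at infinity vanishes. -/
theorem Monotone.eq_zero_of_pow_le {F k : ℝ → ℝ} (hF : Monotone F) (hk : Integrable k)
    (j : ℕ) (h : ∀ x, |F x| ^ j ≤ (1 + |x|) * k x) (x : ℝ) : F x = 0 := by
  -- For x > 1 one has 1 + x ≤ 2x, so the bound would dominate 1/x by the integrable function (2/c)
  -- l.
  have tail : ∀ {c a : ℝ} {l : ℝ → ℝ}, 0 < c → Integrable l →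
      (∀ x, a ≤ x → c ≤ (1 + |x|) * l x) → False := by
    intro c a l hc hl hx
    refine not_integrableOn_Ioi_inv (a := max a 1) ?_
    refine ((hl.const_mul (2 / c)).integrableOn (s := Ioi (max a 1))).mono'
      measurable_inv.aestronglyMeasurable ?_
    filter_upwards [ae_restrict_mem measurableSet_Ioi] with x hx'
    have hx1 : 1 < x := (le_max_right _ _).trans_lt hx'
    have := hx x ((le_max_left a 1).trans hx'.le)
    rw [abs_of_pos (by linarith)] at this
    have hlx : 0 < l x := by
      by_contra hn
      nlinarith
    rw [Real.norm_eq_abs, abs_of_pos (by positivity), inv_le_iff_one_le_mul₀ (by linarith),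
      div_mul_eq_mul_div, div_mul_eq_mul_div, le_div_iff₀ hc]
    nlinarith
  rcases lt_trichotomy (F x) 0 with hx | hx | hx
  · exfalso
    refine tail (c := |F x| ^ j) (a := -x) (l := fun y => k (-y))
      (pow_pos (abs_pos.2 hx.ne) j) hk.comp_neg ?_
    intro y hy
    have h1 : F (-y) ≤ F x := hF (by linarith)
    have h2 := h (-y)
    rw [abs_neg] at h2
    refine le_trans ?_ h2
    refine pow_le_pow_left₀ (abs_nonneg _) ?_ j
    rw [abs_of_neg hx, abs_of_neg (by linarith)]
    linarith
  · exact hx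
  · exfalso
    refine tail (c := |F x| ^ j) (a := x) (pow_pos (abs_pos.2 hx.ne') j) hk ?_
    intro y hy
    refine le_trans ?_ (h y)
    refine pow_le_pow_left₀ (abs_nonneg _) ?_ j
    rw [abs_of_pos hx, abs_of_pos (hx.trans_le (hF hy))]
    exact hF hy

/-- If `F' ≥ 0` and `F` is small on average at infinity then `F' = 0`. -/
theorem deriv_eq_zero_of_pow_le {F F' k : ℝ → ℝ} (hF : ∀ x, HasDerivAt F (F' x) x)
    (hF' : ∀ x, 0 ≤ F' x) (hk : Integrable k)
    (j : ℕ) (h : ∀ x, |F x| ^ j ≤ (1 + |x|) * k x) (x : ℝ) : F' x = 0 := by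
  have hm : Monotone F := monotone_of_hasDerivAt_nonneg hF hF'
  have h0 : F = fun _ => 0 := funext (Monotone.eq_zero_of_pow_le hm hk j h)
  have := hF x
  rw [h0] at this
  exact this.unique (hasDerivAt_const x 0)

end NLS

/-! ### Nonexistence for weakly coupled repulsive systems -/

namespace NLS

/-- Expand the square of c x + (a/c) y. The parameter c decides how a cross term is shared between
the two squares that absorb it. -/
theorem young_scaled {a M c : ℝ} (x y : ℝ) (hc : 0 < c) (h : |a| ≤ M) :
    0 ≤ c ^ 2 * x ^ 2 + (M / c) ^ 2 * y ^ 2 + 2 * a * x * y := by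
  have h1 : a ^ 2 ≤ M ^ 2 := sq_le_sq' (abs_le.1 h).1 (abs_le.1 h).2
  have h2 : (a / c) ^ 2 ≤ (M / c) ^ 2 := by rw [div_pow, div_pow]; gcongr
  have h3 := sq_nonneg (c * x + a / c * y)
  have h4 : (c * x + a / c * y) ^ 2 = c ^ 2 * x ^ 2 + 2 * a * x * y + (a / c) ^ 2 * y ^ 2 := by
    field_simp
    ring
  nlinarith [mul_le_mul_of_nonneg_right h2 (sq_nonneg y)]

/-- The coefficients `b, q` of a two-component Schrödinger system, small and localized by a weight
`φ`, such that `b` is the sum of a large nonnegative function `ι` and an exact derivative. -/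
structure RepulsiveCoefficients (k ε : ℝ) (φ b b₁ q q₁ β ι : ℝ → ℝ) : Prop where
  k_pos : 0 < k
  ε_pos : 0 < ε
  ε_le : ε ≤ 1 / 1000
  φ_pos : ∀ x, 0 < φ x
  φ_le : ∀ x, φ x ≤ 2 * k
  φ_sq : Integrable fun x => φ x ^ 2
  hasDerivAt_b : ∀ x, HasDerivAt b (b₁ x) x
  hasDerivAt_q : ∀ x, HasDerivAt q (q₁ x) x
  hasDerivAt_β : ∀ x, HasDerivAt β (b x - ι x) x
  le_ι : ∀ x, 4000 * ε ^ 2 * φ x ^ 2 ≤ ι x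
  abs_b : ∀ x, |b x| ≤ 3 * ε * φ x ^ 2
  abs_q : ∀ x, |q x| ≤ 3 * ε * φ x ^ 2
  abs_β : ∀ x, |β x| ≤ 20 * ε * φ x
  abs_mul_b : ∀ x, |x * b x| ≤ 6 * ε * φ x
  abs_mul_b₁ : ∀ x, |x * b₁ x| ≤ 20 * ε * k * φ x
  abs_mul_q₁ : ∀ x, |x * q₁ x| ≤ 20 * ε * k * φ x

namespace RepulsiveCoefficients

variable {k ε : ℝ} {φ b b₁ q q₁ β ι : ℝ → ℝ}

theorem abs_b_le (h : RepulsiveCoefficients k ε φ b b₁ q q₁ β ι) (x : ℝ) :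
    |b x| ≤ k ^ 2 / 4 := by
  have h1 : φ x ^ 2 ≤ (2 * k) ^ 2 := pow_le_pow_left₀ (h.φ_pos x).le (h.φ_le x) 2
  have h2 := mul_le_mul h.ε_le h1 (sq_nonneg _) (by norm_num)
  have := h.abs_b x
  nlinarith [sq_nonneg k]

theorem abs_q_le (h : RepulsiveCoefficients k ε φ b b₁ q q₁ β ι) (x : ℝ) :
    |q x| ≤ 6 * ε * k * φ x := by
  have h1 := mul_le_mul_of_nonneg_left (h.φ_le x) (mul_pos h.ε_pos (h.φ_pos x)).le
  have := h.abs_q x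
  nlinarith

theorem abs_q_le' (h : RepulsiveCoefficients k ε φ b b₁ q q₁ β ι) (x : ℝ) :
    |q x| ≤ k ^ 2 / 4 := by
  have h1 : φ x ^ 2 ≤ (2 * k) ^ 2 := pow_le_pow_left₀ (h.φ_pos x).le (h.φ_le x) 2
  have h2 := mul_le_mul h.ε_le h1 (sq_nonneg _) (by norm_num)
  have := h.abs_q x
  nlinarith [sq_nonneg k]

theorem abs_mul_b₁_le (h : RepulsiveCoefficients k ε φ b b₁ q q₁ β ι) (x : ℝ) :
    |x * b₁ x| ≤ k ^ 2 / 4 := by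
  have h1 := h.abs_mul_b₁ x
  have h2 := mul_le_mul h.ε_le (h.φ_le x) (h.φ_pos x).le (by norm_num)
  have h3 := mul_le_mul_of_nonneg_left h2 h.k_pos.le
  nlinarith [sq_nonneg k]

theorem eq_zero_of_sum_eq_zero (h : RepulsiveCoefficients k ε φ b b₁ q q₁ β ι) {P D c : ℝ} (x : ℝ)
    (hc : 0 < c) (hs : c * (ε ^ 2 * φ x ^ 2 * P ^ 2) + c * (k ^ 2 * D ^ 2) ≤ 0) :
    P = 0 ∧ D = 0 := by
  have hε := h.ε_pos
  have hφ := h.φ_pos x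
  have hk := h.k_pos
  constructor
  · by_contra hP
    have : 0 < c * (ε ^ 2 * φ x ^ 2 * P ^ 2) := by positivity
    have : 0 ≤ c * (k ^ 2 * D ^ 2) := by positivity
    linarith
  · by_contra hP
    have : 0 ≤ c * (ε ^ 2 * φ x ^ 2 * P ^ 2) := by positivity
    have : 0 < c * (k ^ 2 * D ^ 2) := by positivity
    linarith

/-- Below the threshold: an energy estimate excludes bounded solutions. -/
theorem eq_zero_of_le (h : RepulsiveCoefficients k ε φ b b₁ q q₁ β ι) {lam : ℝ} (h0 : 0 < lam)
    (hlam : lam ≤ k ^ 2) {P P₁ D D₁ : ℝ → ℝ}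
    (hP : ∀ x, HasDerivAt P (P₁ x) x) (hD : ∀ x, HasDerivAt D (D₁ x) x)
    (hP₁ : ∀ x, HasDerivAt P₁ ((k ^ 2 - lam + b x) * P x + q x * D x) x)
    (hD₁ : ∀ x, HasDerivAt D₁ ((k ^ 2 + lam + b x) * D x + q x * P x) x)
    {C : ℝ} (hPC : ∀ x, |P x| ≤ C) (hDC : ∀ x, |D x| ≤ C)
    (hP₁i : Integrable fun x => P₁ x ^ 2) (hD₁i : Integrable fun x => D₁ x ^ 2) (x : ℝ) :
    P x = 0 ∧ D x = 0 := by
  have hk := h.k_pos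
  have hε := h.ε_pos
  -- Because β' = b - ι, the summand -βP² of F replaces bP² by ιP², at the price of the cross term
  -- -2βPP₁.
  set F' : ℝ → ℝ := fun x => P₁ x ^ 2 + (k ^ 2 - lam) * P x ^ 2 + ι x * P x ^ 2
    - 2 * β x * P x * P₁ x + D₁ x ^ 2 + (k ^ 2 + lam + b x) * D x ^ 2
    + 2 * q x * P x * D x with hF'
  have hF : ∀ x, HasDerivAt (fun x => P x * P₁ x + D x * D₁ x - β x * P x ^ 2) (F' x) x := by
    intro x
    have := (((hP x).mul (hP₁ x)).add ((hD x).mul (hD₁ x))).sub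
      ((h.hasDerivAt_β x).mul ((hP x).pow 2))
    refine this.congr_deriv ?_
    simp only [hF', Pi.pow_apply]
    push_cast
    ring
  -- In units of ε²φ²P², the cross terms in β and q cost 400 and 144, against the 4000 supplied by
  -- ι. The remaining costs are P₁² and fractions of k²D².
  have low : ∀ x, ε ^ 2 * φ x ^ 2 * P x ^ 2 + (1 / 4) * (k ^ 2 * D x ^ 2) ≤ F' x := by
    intro x
    have y1 := young_scaled (P₁ x) (P x) one_pos
      (by rw [abs_neg]; exact h.abs_β x : |-β x| ≤ 20 * ε * φ x)
    have y2 := young_scaled (D x) (P x) (half_pos hk) (h.abs_q_le x)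
    have e2 : (6 * ε * k * φ x / (k / 2)) ^ 2 = 144 * (ε ^ 2 * φ x ^ 2) := by
      field_simp; ring
    rw [e2] at y2
    have y3 := mul_le_mul_of_nonneg_right (h.le_ι x) (sq_nonneg (P x))
    have y4 := mul_le_mul_of_nonneg_right (abs_le.1 (h.abs_b_le x)).1 (sq_nonneg (D x))
    have y5 : 0 ≤ (k ^ 2 - lam) * P x ^ 2 := mul_nonneg (by linarith) (sq_nonneg _)
    have y6 : 0 ≤ lam * D x ^ 2 := by positivity
    have y7 : 0 ≤ ε ^ 2 * φ x ^ 2 * P x ^ 2 := by positivity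
    have y8 : 0 ≤ k ^ 2 * D x ^ 2 := by positivity
    have y9 : 0 ≤ D₁ x ^ 2 := by positivity
    simp only [hF']
    nlinarith
  have hnn : ∀ x, 0 ≤ F' x := fun x => le_trans (by positivity) (low x)
  have hz := deriv_eq_zero_of_pow_le hF hnn (k := fun x => 3 * (C ^ 2 * P₁ x ^ 2
      + C ^ 2 * D₁ x ^ 2 + (20 * ε * C ^ 2) ^ 2 * φ x ^ 2))
    (((hP₁i.const_mul _).add (hD₁i.const_mul _)).add (h.φ_sq.const_mul _) |>.const_mul 3) 2
    (fun x => by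
      rw [sq_abs]
      have hP2 : P x ^ 2 ≤ C ^ 2 := sq_le_sq' (abs_le.1 (hPC x)).1 (abs_le.1 (hPC x)).2
      have hD2 : D x ^ 2 ≤ C ^ 2 := sq_le_sq' (abs_le.1 (hDC x)).1 (abs_le.1 (hDC x)).2
      have hβ2 : β x ^ 2 ≤ (20 * ε * φ x) ^ 2 :=
        sq_le_sq' (abs_le.1 (h.abs_β x)).1 (abs_le.1 (h.abs_β x)).2
      have z1 := mul_le_mul_of_nonneg_right hP2 (sq_nonneg (P₁ x))
      have z2 := mul_le_mul_of_nonneg_right hD2 (sq_nonneg (D₁ x))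
      have z3 : β x ^ 2 * (P x ^ 2) ^ 2 ≤ (20 * ε * φ x) ^ 2 * (C ^ 2) ^ 2 := by gcongr
      have z4 : 0 ≤ 3 * (C ^ 2 * P₁ x ^ 2 + C ^ 2 * D₁ x ^ 2
        + (20 * ε * C ^ 2) ^ 2 * φ x ^ 2) := by positivity
      have z5 : (P x * P₁ x + D x * D₁ x - β x * P x ^ 2) ^ 2 ≤ 3 * (P x ^ 2 * P₁ x ^ 2
          + D x ^ 2 * D₁ x ^ 2 + β x ^ 2 * (P x ^ 2) ^ 2) := by
        nlinarith [sq_nonneg (P x * P₁ x - D x * D₁ x), sq_nonneg (P x * P₁ x + β x * P x ^ 2),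
          sq_nonneg (D x * D₁ x + β x * P x ^ 2)]
      have z6 := mul_nonneg (abs_nonneg x) z4
      nlinarith)
  refine h.eq_zero_of_sum_eq_zero (c := 1 / 4) x (by norm_num) ?_
  have := low x
  rw [hz x] at this
  have y7 : 0 ≤ ε ^ 2 * φ x ^ 2 * P x ^ 2 := by positivity
  linarith

/-- Above the threshold: a virial estimate excludes square integrable solutions. -/
theorem eq_zero_of_lt (h : RepulsiveCoefficients k ε φ b b₁ q q₁ β ι) {lam : ℝ}
    (hlam : k ^ 2 < lam) {P P₁ D D₁ : ℝ → ℝ}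
    (hP : ∀ x, HasDerivAt P (P₁ x) x) (hD : ∀ x, HasDerivAt D (D₁ x) x)
    (hP₁ : ∀ x, HasDerivAt P₁ ((k ^ 2 - lam + b x) * P x + q x * D x) x)
    (hD₁ : ∀ x, HasDerivAt D₁ ((k ^ 2 + lam + b x) * D x + q x * P x) x)
    (hPi : Integrable fun x => P x ^ 2) (hDi : Integrable fun x => D x ^ 2)
    (hP₁i : Integrable fun x => P₁ x ^ 2) (hD₁i : Integrable fun x => D₁ x ^ 2) (x : ℝ) :
    P x = 0 ∧ D x = 0 := by
  have hk := h.k_pos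
  have hε := h.ε_pos
  -- The term bP² is deliberately left out: x A' then contains 2xbPP₁, which costs order ε² after
  -- Young, instead of x b₁ P², of order ε and out of reach of ι.
  set A : ℝ → ℝ := fun x => P₁ x ^ 2 + (lam - k ^ 2) * P x ^ 2 + D₁ x ^ 2
    - (k ^ 2 + lam + b x) * D x ^ 2 - 2 * q x * P x * D x with hA
  -- The multiplier PP₁ cancels (λ - k²)P² coming from A, while the weight 2 on DD₁ turns the
  -- negative D² term of A into a positive one.
  set B : ℝ → ℝ := fun x => P x * P₁ x + 2 * (D x * D₁ x) - β x * P x ^ 2 with hB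
  set F' : ℝ → ℝ := fun x => 2 * P₁ x ^ 2 + 3 * D₁ x ^ 2 + ι x * P x ^ 2
    - 2 * (β x - x * b x) * P x * P₁ x - x * b₁ x * D x ^ 2 - 2 * (x * q₁ x) * P x * D x
    + (k ^ 2 + lam + b x) * D x ^ 2 + q x * P x * D x with hF'
  have hF : ∀ x, HasDerivAt (fun x => x * A x + B x) (F' x) x := by
    intro x
    have hA' := (((((hP₁ x).pow 2).add (((hP x).pow 2).const_mul (lam - k ^ 2))).add
      ((hD₁ x).pow 2)).sub (((h.hasDerivAt_b x).const_add (k ^ 2 + lam)).mul ((hD x).pow 2))).sub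
      ((((h.hasDerivAt_q x).const_mul 2).mul (hP x)).mul (hD x))
    have hB' := (((hP x).mul (hP₁ x)).add (((hD x).mul (hD₁ x)).const_mul 2)).sub
      ((h.hasDerivAt_β x).mul ((hP x).pow 2))
    have := ((hasDerivAt_id x).mul hA').add hB'
    refine this.congr_deriv ?_
    simp only [hF', Pi.pow_apply, Pi.add_apply, Pi.sub_apply, Pi.mul_apply, id_eq]
    push_cast
    ring
  -- The costs are now 26² = 676, 1600 and 144/2 = 72 in units of ε²φ²P², still below 4000.
  have low : ∀ x, ε ^ 2 * φ x ^ 2 * P x ^ 2 + (1 / 4) * (k ^ 2 * D x ^ 2) ≤ F' x := by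
    intro x
    have hγ : |-(β x - x * b x)| ≤ 26 * ε * φ x := by
      rw [abs_neg]
      have := abs_sub (β x) (x * b x)
      have := h.abs_β x
      have := h.abs_mul_b x
      linarith
    have y1 := young_scaled (P₁ x) (P x) one_pos hγ
    have hq₁ : |-(x * q₁ x)| ≤ 20 * ε * k * φ x := by rw [abs_neg]; exact h.abs_mul_q₁ x
    have y2 := young_scaled (D x) (P x) (half_pos hk) hq₁
    have e2 : (20 * ε * k * φ x / (k / 2)) ^ 2 = 1600 * (ε ^ 2 * φ x ^ 2) := by
      field_simp; ring
    rw [e2] at y2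
    have y2' := young_scaled (D x) (P x) (half_pos hk) (h.abs_q_le x)
    have e2' : (6 * ε * k * φ x / (k / 2)) ^ 2 = 144 * (ε ^ 2 * φ x ^ 2) := by
      field_simp; ring
    rw [e2'] at y2'
    have y3 := mul_le_mul_of_nonneg_right (h.le_ι x) (sq_nonneg (P x))
    have y4 := mul_le_mul_of_nonneg_right (abs_le.1 (h.abs_b_le x)).1 (sq_nonneg (D x))
    have y5 := mul_le_mul_of_nonneg_right (abs_le.1 (h.abs_mul_b₁_le x)).2 (sq_nonneg (D x))
    have y6 := mul_le_mul_of_nonneg_right hlam.le (sq_nonneg (D x))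
    have y7 : 0 ≤ ε ^ 2 * φ x ^ 2 * P x ^ 2 := by positivity
    have y8 : 0 ≤ k ^ 2 * D x ^ 2 := by positivity
    have y9 : 0 ≤ D₁ x ^ 2 := by positivity
    have y10 : 0 ≤ P₁ x ^ 2 := by positivity
    simp only [hF']
    nlinarith
  have hnn : ∀ x, 0 ≤ F' x := fun x => le_trans (by positivity) (low x)
  set M : ℝ := 2 + 2 * lam + k ^ 2 + 20 * ε * (2 * k) with hM
  have hlam0 : 0 < lam := lt_of_le_of_lt (sq_nonneg k) hlam
  have hk2 : 0 < k ^ 2 := by positivity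
  have hεk : 0 < ε * k := by positivity
  -- The virial functional grows like |x| times an integrable function, which is exactly what the
  -- factor 1 + |x| allows with exponent 1.
  have hz := deriv_eq_zero_of_pow_le hF hnn
    (k := fun x => M * (P x ^ 2 + P₁ x ^ 2 + D x ^ 2 + D₁ x ^ 2))
    ((((hPi.add hP₁i).add hDi).add hD₁i).const_mul M) 1
    (fun x => by
      rw [pow_one]
      have b1 := abs_le.1 (h.abs_b_le x)
      have q1 := abs_le.1 (h.abs_q_le' x)
      have β1 : |β x| ≤ 20 * ε * (2 * k) := (h.abs_β x).trans (by have := h.φ_le x; gcongr)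
      have β2 := abs_le.1 β1
      have p0 := sq_nonneg (P x)
      have p1 := sq_nonneg (P₁ x)
      have d0 := sq_nonneg (D x)
      have d1 := sq_nonneg (D₁ x)
      have pd1 := sq_nonneg (P x - D x)
      have pd2 := sq_nonneg (P x + D x)
      have hqPD : |2 * q x * P x * D x| ≤ k ^ 2 / 4 * (P x ^ 2 + D x ^ 2) := by
        have : |2 * q x * P x * D x| = |q x| * |2 * (P x * D x)| := by
          rw [← abs_mul]; congr 1; ring
        rw [this]
        refine mul_le_mul (h.abs_q_le' x) ?_ (abs_nonneg _) (by positivity)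
        rw [abs_le]
        constructor <;> nlinarith
      have hqPD' := abs_le.1 hqPD
      have e1 := mul_nonneg (sub_nonneg.2 b1.2) d0
      have e2 := mul_nonneg (sub_nonneg.2 b1.1) d0
      have e3 := mul_nonneg (sub_nonneg.2 β2.2) p0
      have e4 := mul_nonneg (sub_nonneg.2 β2.1) p0
      have f0 := mul_nonneg (sub_nonneg.2 hlam.le) p0
      have f0' := mul_nonneg (sub_nonneg.2 hlam.le) d0
      have f1 := mul_nonneg hlam0.le p0
      have f2 := mul_nonneg hlam0.le p1
      have f3 := mul_nonneg hlam0.le d0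
      have f4 := mul_nonneg hlam0.le d1
      have g1 := mul_nonneg hk2.le p0
      have g2 := mul_nonneg hk2.le p1
      have g3 := mul_nonneg hk2.le d0
      have g4 := mul_nonneg hk2.le d1
      have i1 := mul_nonneg hεk.le p0
      have i2 := mul_nonneg hεk.le p1
      have i3 := mul_nonneg hεk.le d0
      have i4 := mul_nonneg hεk.le d1
      have hAx : |A x| ≤ M * (P x ^ 2 + P₁ x ^ 2 + D x ^ 2 + D₁ x ^ 2) := by
        rw [abs_le]
        simp only [hA, hM]
        constructor <;> linarith
      have hBx : |B x| ≤ M * (P x ^ 2 + P₁ x ^ 2 + D x ^ 2 + D₁ x ^ 2) := by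
        have s1 := sq_nonneg (P x - P₁ x)
        have s2 := sq_nonneg (P x + P₁ x)
        have s3 := sq_nonneg (D x - D₁ x)
        have s4 := sq_nonneg (D x + D₁ x)
        rw [abs_le]
        simp only [hB, hM]
        constructor <;> linarith
      have t1 := abs_add_le (x * A x) (B x)
      rw [abs_mul] at t1
      have t2 := mul_le_mul_of_nonneg_left hAx (abs_nonneg x)
      linarith)
  refine h.eq_zero_of_sum_eq_zero (c := 1 / 4) x (by norm_num) ?_
  have := low x
  rw [hz x] at this
  have y7 : 0 ≤ ε ^ 2 * φ x ^ 2 * P x ^ 2 := by positivity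
  linarith

end RepulsiveCoefficients

theorem HasDerivAt.re_comp {f : ℝ → ℂ} {f' : ℂ} {x : ℝ} (h : HasDerivAt f f' x) :
    HasDerivAt (fun x => (f x).re) f'.re x :=
  Complex.reCLM.hasFDerivAt.comp_hasDerivAt x h

theorem HasDerivAt.im_comp {f : ℝ → ℂ} {f' : ℂ} {x : ℝ} (h : HasDerivAt f f' x) :
    HasDerivAt (fun x => (f x).im) f'.im x :=
  Complex.imCLM.hasFDerivAt.comp_hasDerivAt x h

/-- Positivity of both operators excludes non-real spectral parameters. -/
theorem eq_zero_of_im_ne_zero {A B : ℝ → ℝ} {c : ℝ} (hc : 0 < c) (hA : ∀ x, c ≤ A x)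
    (hB : ∀ x, c ≤ B x) {lam : ℂ} (hlam : lam.im ≠ 0) {V V₁ W W₁ : ℝ → ℂ}
    (hV : ∀ x, HasDerivAt V (V₁ x) x) (hW : ∀ x, HasDerivAt W (W₁ x) x)
    (hV₁ : ∀ x, HasDerivAt V₁ (A x * V x - lam * W x) x)
    (hW₁ : ∀ x, HasDerivAt W₁ (B x * W x - lam * V x) x)
    {C : ℝ} (hVC : ∀ x, ‖V x‖ ≤ C) (hWC : ∀ x, ‖W x‖ ≤ C)
    (hV₁i : Integrable fun x => ‖V₁ x‖ ^ 2) (hW₁i : Integrable fun x => ‖W₁ x‖ ^ 2) (x : ℝ) :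
    V x = 0 ∧ W x = 0 := by
  set F' : ℝ → ℝ := fun x => lam.im ^ 2 * (‖V₁ x‖ ^ 2 + A x * ‖V x‖ ^ 2 + ‖W₁ x‖ ^ 2
    + B x * ‖W x‖ ^ 2) with hF'
  -- The factor conj λ turns the coupling into |λ|² times a real quantity, so the imaginary part of
  -- Z' sees only the positive quadratic form.
  set Z : ℝ → ℂ := fun x => (starRingEnd ℂ) lam * (V₁ x * (starRingEnd ℂ) (V x)
    + W₁ x * (starRingEnd ℂ) (W x)) with hZ
  have hF : ∀ x, HasDerivAt (fun x => -lam.im * (Z x).im) (F' x) x := by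
    intro x
    have hZ' := (((hV₁ x).mul (hV x).star).add ((hW₁ x).mul (hW x).star)).const_mul
      ((starRingEnd ℂ) lam)
    have := (HasDerivAt.im_comp hZ').const_mul (-lam.im)
    refine this.congr_deriv ?_
    simp only [hF', Complex.sq_norm, Complex.normSq_apply, Complex.star_def,
      Complex.add_im, Complex.mul_im, Complex.sub_im, Complex.conj_re,
      Complex.conj_im, Complex.add_re, Complex.mul_re, Complex.sub_re, Complex.ofReal_re,
      Complex.ofReal_im]
    ring
  have h2 : 0 < lam.im ^ 2 := by positivity
  have low : ∀ x, lam.im ^ 2 * (c * ‖V x‖ ^ 2 + c * ‖W x‖ ^ 2) ≤ F' x := by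
    intro x
    refine mul_le_mul_of_nonneg_left ?_ h2.le
    have := mul_le_mul_of_nonneg_right (hA x) (sq_nonneg ‖V x‖)
    have := mul_le_mul_of_nonneg_right (hB x) (sq_nonneg ‖W x‖)
    have := sq_nonneg ‖V₁ x‖
    have := sq_nonneg ‖W₁ x‖
    linarith
  have hnn : ∀ x, 0 ≤ F' x := fun x => le_trans (by positivity) (low x)
  have hz := deriv_eq_zero_of_pow_le hF hnn (k := fun x => 2 * (|lam.im| * ‖lam‖ * C) ^ 2 *
      (‖V₁ x‖ ^ 2 + ‖W₁ x‖ ^ 2)) ((hV₁i.add hW₁i).const_mul _) 2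
    (fun x => by
      have hC : 0 ≤ C := (norm_nonneg _).trans (hVC x)
      have z1 : |-lam.im * (Z x).im| ≤ |lam.im| * ‖lam‖ * C * (‖V₁ x‖ + ‖W₁ x‖) := by
        rw [abs_mul, abs_neg]
        have : |(Z x).im| ≤ ‖lam‖ * (‖V₁ x‖ * C + ‖W₁ x‖ * C) := by
          refine (Complex.abs_im_le_norm _).trans ?_
          simp only [hZ]
          rw [norm_mul, RCLike.norm_conj]
          refine mul_le_mul_of_nonneg_left ((norm_add_le _ _).trans ?_) (norm_nonneg _)
          rw [norm_mul, norm_mul, RCLike.norm_conj, RCLike.norm_conj]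
          have := hVC x
          have := hWC x
          gcongr
        have := mul_le_mul_of_nonneg_left this (abs_nonneg lam.im)
        nlinarith
      have z2 := pow_le_pow_left₀ (abs_nonneg _) z1 2
      have z3 : (‖V₁ x‖ + ‖W₁ x‖) ^ 2 ≤ 2 * (‖V₁ x‖ ^ 2 + ‖W₁ x‖ ^ 2) := by
        nlinarith [sq_nonneg (‖V₁ x‖ - ‖W₁ x‖)]
      have z4 := mul_le_mul_of_nonneg_left z3 (sq_nonneg (|lam.im| * ‖lam‖ * C))
      have z5 : 0 ≤ |x| * (2 * (|lam.im| * ‖lam‖ * C) ^ 2 * (‖V₁ x‖ ^ 2 + ‖W₁ x‖ ^ 2)) := by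
        positivity
      rw [mul_pow] at z2
      linarith)
  have h3 := low x
  rw [hz x] at h3
  have h4 : c * ‖V x‖ ^ 2 + c * ‖W x‖ ^ 2 ≤ 0 := by
    by_contra hn
    have := mul_pos h2 (not_le.1 hn)
    linarith
  have h5 : 0 ≤ c * ‖V x‖ ^ 2 := by positivity
  have h6 : 0 ≤ c * ‖W x‖ ^ 2 := by positivity
  have h7 : c * ‖V x‖ ^ 2 = 0 := by linarith
  have h8 : c * ‖W x‖ ^ 2 = 0 := by linarith
  constructor
  · simpa [hc.ne'] using h7
  · simpa [hc.ne'] using h8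

end NLS

/-! ### The transformed system -/

namespace NLS

/-- A positive function `φ` with `φ' = p φ` and `φ'' = n φ`, where `n' = 2 p l`, together with the
bounds that hold for a solitary wave. The linearized operators around it are
`-∂ₓ² + n` and `-∂ₓ² + n + 2 l`. -/
structure IsProfile (ω : ℝ) (φ p n l : ℝ → ℝ) : Prop where
  pos : ∀ x, 0 < φ x
  hasDerivAt : ∀ x, HasDerivAt φ (p x * φ x) x
  hasDerivAt_p : ∀ x, HasDerivAt p (n x - p x ^ 2) x
  hasDerivAt_n : ∀ x, HasDerivAt n (2 * p x * l x) x
  continuous_l : Continuous l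
  p_zero : p 0 = 0
  n_zero : n 0 ≠ 0
  sq_integrable : Integrable fun x => φ x ^ 2
  bound : ∃ C, ∀ x, |p x| ≤ C ∧ |n x| ≤ C ∧ |l x| ≤ C ∧ |n x - ω| ≤ C * φ x ∧
    |n x - p x ^ 2| ≤ C * φ x ∧ |l x| ≤ C * φ x ∧ φ x ≤ C

/-- A classical solution of the linearized system that is bounded, with square integrable first
and second derivatives. -/
structure IsClassicalResonance (n l : ℝ → ℝ) (lam : ℂ) (X X₁ Y Y₁ : ℝ → ℂ) : Prop where
  hasDerivAt_X : ∀ x, HasDerivAt X (X₁ x) x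
  hasDerivAt_Y : ∀ x, HasDerivAt Y (Y₁ x) x
  hasDerivAt_X₁ : ∀ x, HasDerivAt X₁ (n x * X x - lam * Y x) x
  hasDerivAt_Y₁ : ∀ x, HasDerivAt Y₁ ((n x + 2 * l x) * Y x - lam * X x) x
  bound : ∃ C, ∀ x, ‖X x‖ ≤ C ∧ ‖Y x‖ ≤ C
  memLp_X₁ : MemLp X₁ 2 volume
  memLp_Y₁ : MemLp Y₁ 2 volume
  memLp_X₂ : MemLp (fun x => n x * X x - lam * Y x) 2 volume
  memLp_Y₂ : MemLp (fun x => (n x + 2 * l x) * Y x - lam * X x) 2 volume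

theorem continuous_of_hasDerivAt {E : Type*} [NormedAddCommGroup E] [NormedSpace ℝ E]
    {f f' : ℝ → E} (h : ∀ x, HasDerivAt f (f' x) x) : Continuous f :=
  continuous_iff_continuousAt.2 fun x => (h x).continuousAt

/-- A bounded function with bounded second derivative has a bounded first derivative. -/
theorem norm_deriv_le {f f₁ f₂ : ℝ → ℂ} (h : ∀ x, HasDerivAt f (f₁ x) x)
    (h₁ : ∀ x, HasDerivAt f₁ (f₂ x) x) {C M : ℝ} (hC : ∀ x, ‖f x‖ ≤ C) (hM : ∀ x, ‖f₂ x‖ ≤ M)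
    (x : ℝ) : ‖f₁ x‖ ≤ 2 * C + M := by
  have hM0 : 0 ≤ M := (norm_nonneg _).trans (hM 0)
  -- Over a unit interval f₁ varies by at most M, so f₁ x differs from the increment f (x + 1) - f x
  -- by at most M.
  have a1 : ∀ t ∈ Icc x (x + 1), ‖f₁ t - f₁ x‖ ≤ M := fun t ht => by
    have := (convex_univ (𝕜 := ℝ) (E := ℝ)).norm_image_sub_le_of_norm_hasDerivWithin_le
      (fun y _ => (h₁ y).hasDerivWithinAt) (fun y _ => hM y) (mem_univ x) (mem_univ t)
    refine this.trans ?_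
    rw [Real.norm_eq_abs, abs_of_nonneg (by linarith [ht.1])]
    nlinarith [ht.1, ht.2]
  have a2 := (convex_Icc x (x + 1)).norm_image_sub_le_of_norm_hasDerivWithin_le
      (f := fun t : ℝ => f t - (t : ℂ) * f₁ x) (f' := fun t => f₁ t - f₁ x) (C := M)
      (fun t _ => by
        have := (h t).sub ((hasDerivAt_id t).ofReal_comp.mul_const (f₁ x))
        refine (this.congr_deriv ?_).hasDerivWithinAt
        simp) a1 (left_mem_Icc.2 (by linarith)) (right_mem_Icc.2 (by linarith))
  have e : f₁ x = f (x + 1) - f x -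
      ((f (x + 1) - ((x + 1 : ℝ) : ℂ) * f₁ x) - (f x - (x : ℂ) * f₁ x)) := by
    push_cast; ring
  rw [add_sub_cancel_left, norm_one, mul_one] at a2
  rw [e]
  refine (norm_sub_le _ _).trans ?_
  have := norm_sub_le (f (x + 1)) (f x)
  have := hC x
  have := hC (x + 1)
  linarith

theorem memLp_two_of_norm_le {f : ℝ → ℂ} (hf : Continuous f) {φ : ℝ → ℝ}
    (hφ : Integrable fun x => φ x ^ 2) {C : ℝ} (h : ∀ x, ‖f x‖ ≤ C * φ x) :
    MemLp f 2 volume := by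
  rw [memLp_two_iff_integrable_sq_norm hf.aestronglyMeasurable]
  refine (hφ.const_mul (C ^ 2)).mono' (hf.norm.pow 2).aestronglyMeasurable (ae_of_all _ fun x => ?_)
  rw [Real.norm_eq_abs, abs_of_nonneg (sq_nonneg _), ← mul_pow]
  exact pow_le_pow_left₀ (norm_nonneg _) (h x) 2

theorem MemLp.bdd_mul_two {a f : ℝ → ℂ} (ha : Continuous a) {C : ℝ} (h : ∀ x, ‖a x‖ ≤ C)
    (hf : MemLp f 2 volume) : MemLp (fun x => a x * f x) 2 volume :=
  hf.of_le_mul (ha.aestronglyMeasurable.mul hf.aestronglyMeasurable)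
    (ae_of_all _ fun x => by rw [norm_mul]; gcongr; exact h x)

theorem MemLp.integrable_sq_re {f : ℝ → ℂ} (hf : MemLp f 2 volume) :
    Integrable fun x => (f x).re ^ 2 :=
  hf.re.integrable_sq

theorem MemLp.integrable_sq_im {f : ℝ → ℂ} (hf : MemLp f 2 volume) :
    Integrable fun x => (f x).im ^ 2 :=
  hf.im.integrable_sq

variable {ω : ℝ} {φ p n l : ℝ → ℝ} {lam : ℂ} {X X₁ Y Y₁ : ℝ → ℂ}

theorem IsProfile.continuous (h : IsProfile ω φ p n l) : Continuous φ :=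
  continuous_of_hasDerivAt h.hasDerivAt

theorem IsProfile.continuous_p (h : IsProfile ω φ p n l) : Continuous p :=
  continuous_of_hasDerivAt h.hasDerivAt_p

theorem IsProfile.continuous_n (h : IsProfile ω φ p n l) : Continuous n :=
  continuous_of_hasDerivAt h.hasDerivAt_n

namespace IsClassicalResonance

theorem neg (h : IsClassicalResonance n l lam X X₁ Y Y₁) :
    IsClassicalResonance n l (-lam) (-X) (-X₁) Y Y₁ where
  hasDerivAt_X x := (h.hasDerivAt_X x).neg
  hasDerivAt_Y := h.hasDerivAt_Y
  hasDerivAt_X₁ x := by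
    refine (h.hasDerivAt_X₁ x).neg.congr_deriv ?_
    simp only [Pi.neg_apply]
    ring
  hasDerivAt_Y₁ x := by
    refine (h.hasDerivAt_Y₁ x).congr_deriv ?_
    simp only [Pi.neg_apply]
    ring
  bound := by
    obtain ⟨C, hC⟩ := h.bound
    exact ⟨C, fun x => ⟨by rw [Pi.neg_apply, norm_neg]; exact (hC x).1, (hC x).2⟩⟩
  memLp_X₁ := h.memLp_X₁.neg
  memLp_Y₁ := h.memLp_Y₁
  memLp_X₂ := by
    refine h.memLp_X₂.neg.ae_eq (ae_of_all _ fun x => ?_)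
    simp only [Pi.neg_apply]
    ring
  memLp_Y₂ := by
    refine h.memLp_Y₂.ae_eq (ae_of_all _ fun x => ?_)
    simp only [Pi.neg_apply]
    ring

theorem continuous_X (h : IsClassicalResonance n l lam X X₁ Y Y₁) : Continuous X :=
  continuous_of_hasDerivAt h.hasDerivAt_X

theorem continuous_Y (h : IsClassicalResonance n l lam X X₁ Y Y₁) : Continuous Y :=
  continuous_of_hasDerivAt h.hasDerivAt_Y

end IsClassicalResonance

/-- `V = S² X`, where `S = ∂ₓ - p`. -/
def transformedV (p : ℝ → ℝ) (lam : ℂ) (X X₁ Y : ℝ → ℂ) (x : ℝ) : ℂ :=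
  -lam * Y x - 2 * p x * X₁ x + 2 * p x ^ 2 * X x

/-- The derivative of `transformedV`. -/
def transformedV₁ (p n : ℝ → ℝ) (lam : ℂ) (X X₁ Y Y₁ : ℝ → ℂ) (x : ℝ) : ℂ :=
  -lam * Y₁ x + 2 * p x * lam * Y x + (4 * p x ^ 2 - 2 * n x) * (X₁ x - p x * X x)

/-- The image of `Y` under the adjoint of the operator `R` with `L₊ S* = R S`. -/
def transformedW (p n : ℝ → ℝ) (lam : ℂ) (X Y Y₁ : ℝ → ℂ) (x : ℝ) : ℂ :=
  -lam * X x - 2 * p x * Y₁ x + 2 * n x * Y x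

/-- The derivative of `transformedW`. -/
def transformedW₁ (p n : ℝ → ℝ) (lam : ℂ) (X X₁ Y Y₁ : ℝ → ℂ) (x : ℝ) : ℂ :=
  -lam * X₁ x + 2 * p x ^ 2 * Y₁ x - 2 * p x * n x * Y x + 2 * p x * lam * X x

theorem hasDerivAt_transformedV (h : IsProfile ω φ p n l)
    (hr : IsClassicalResonance n l lam X X₁ Y Y₁) (x : ℝ) :
    HasDerivAt (transformedV p lam X X₁ Y) (transformedV₁ p n lam X X₁ Y Y₁ x) x := by
  have hp := (h.hasDerivAt_p x).ofReal_comp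
  have := (((hr.hasDerivAt_Y x).const_mul (-lam)).sub
    ((hp.const_mul 2).mul (hr.hasDerivAt_X₁ x))).add
    (((hp.pow 2).const_mul 2).mul (hr.hasDerivAt_X x))
  refine this.congr_deriv ?_
  simp only [transformedV₁, Pi.pow_apply]
  push_cast
  ring

theorem hasDerivAt_transformedW (h : IsProfile ω φ p n l)
    (hr : IsClassicalResonance n l lam X X₁ Y Y₁) (x : ℝ) :
    HasDerivAt (transformedW p n lam X Y Y₁) (transformedW₁ p n lam X X₁ Y Y₁ x) x := by
  have hp := (h.hasDerivAt_p x).ofReal_comp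
  have hn := (h.hasDerivAt_n x).ofReal_comp
  have := (((hr.hasDerivAt_X x).const_mul (-lam)).sub
    ((hp.const_mul 2).mul (hr.hasDerivAt_Y₁ x))).add
    ((hn.const_mul 2).mul (hr.hasDerivAt_Y x))
  refine this.congr_deriv ?_
  simp only [transformedW₁]
  push_cast
  ring

/-- With the equation for `transformedW₁`, this closes the system in V and W. In the cubic case p² =
ω - φ²/2, n = ω - φ² and l = -φ², so both potentials reduce to ω. -/
theorem hasDerivAt_transformedV₁ (h : IsProfile ω φ p n l)
    (hr : IsClassicalResonance n l lam X X₁ Y Y₁) (x : ℝ) :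
    HasDerivAt (transformedV₁ p n lam X X₁ Y Y₁)
      (((6 * p x ^ 2 - 5 * n x + 2 * l x : ℝ) : ℂ) * transformedV p lam X X₁ Y x
        - lam * transformedW p n lam X Y Y₁ x) x := by
  have hp := (h.hasDerivAt_p x).ofReal_comp
  have hn := (h.hasDerivAt_n x).ofReal_comp
  have := (((hr.hasDerivAt_Y₁ x).const_mul (-lam)).add
    (((hp.const_mul 2).mul_const lam).mul (hr.hasDerivAt_Y x))).add
    ((((hp.pow 2).const_mul 4).sub (hn.const_mul 2)).mul
      ((hr.hasDerivAt_X₁ x).sub (hp.mul (hr.hasDerivAt_X x))))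
  refine this.congr_deriv ?_
  simp only [transformedV, transformedW, Pi.pow_apply, Pi.sub_apply, Pi.mul_apply]
  push_cast
  ring

theorem hasDerivAt_transformedW₁ (h : IsProfile ω φ p n l)
    (hr : IsClassicalResonance n l lam X X₁ Y Y₁) (x : ℝ) :
    HasDerivAt (transformedW₁ p n lam X X₁ Y Y₁)
      (((2 * p x ^ 2 - n x : ℝ) : ℂ) * transformedW p n lam X Y Y₁ x
        - lam * transformedV p lam X X₁ Y x) x := by
  have hp := (h.hasDerivAt_p x).ofReal_comp
  have hn := (h.hasDerivAt_n x).ofReal_comp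
  have := ((((hr.hasDerivAt_X₁ x).const_mul (-lam)).add
    (((hp.pow 2).const_mul 2).mul (hr.hasDerivAt_Y₁ x))).sub
    (((hp.const_mul 2).mul hn).mul (hr.hasDerivAt_Y x))).add
    (((hp.const_mul 2).mul_const lam).mul (hr.hasDerivAt_X x))
  refine this.congr_deriv ?_
  simp only [transformedV, transformedW, Pi.pow_apply, Pi.mul_apply]
  push_cast
  ring

/-! ### Boundedness and square integrability of the transformed functions -/

theorem IsClassicalResonance.exists_bound (h : IsProfile ω φ p n l)
    (hr : IsClassicalResonance n l lam X X₁ Y Y₁) :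
    ∃ C, ∀ x, ‖X x‖ ≤ C ∧ ‖Y x‖ ≤ C ∧ ‖X₁ x‖ ≤ C ∧ ‖Y₁ x‖ ≤ C := by
  obtain ⟨C, hC⟩ := hr.bound
  obtain ⟨K, hK⟩ := h.bound
  have hC0 : 0 ≤ C := (norm_nonneg _).trans (hC 0).1
  have hK0 : 0 ≤ K := (abs_nonneg _).trans (hK 0).1
  have h2 : ∀ x, ‖(n x : ℂ) * X x - lam * Y x‖ ≤ (3 * K + ‖lam‖) * C := fun x => by
    refine (norm_sub_le _ _).trans ?_
    rw [norm_mul, norm_mul, Complex.norm_real, Real.norm_eq_abs]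
    have h1 := mul_le_mul (hK x).2.1 (hC x).1 (norm_nonneg _) hK0
    have h2 := mul_le_mul_of_nonneg_left (hC x).2 (norm_nonneg lam)
    nlinarith
  have h3 : ∀ x, ‖((n x : ℂ) + 2 * l x) * Y x - lam * X x‖ ≤ (3 * K + ‖lam‖) * C := fun x => by
    refine (norm_sub_le _ _).trans ?_
    rw [norm_mul, norm_mul]
    have h0 : ‖(n x : ℂ) + 2 * l x‖ ≤ 3 * K := by
      refine (norm_add_le _ _).trans ?_
      rw [norm_mul, Complex.norm_real, Complex.norm_real, Real.norm_eq_abs, Real.norm_eq_abs]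
      have := (hK x).2.1
      have := (hK x).2.2.1
      norm_num
      linarith
    have h1 := mul_le_mul h0 (hC x).2 (norm_nonneg _) (by positivity)
    have h2 := mul_le_mul_of_nonneg_left (hC x).1 (norm_nonneg lam)
    nlinarith
  refine ⟨2 * C + (3 * K + ‖lam‖) * C, fun x => ⟨?_, ?_,
    norm_deriv_le hr.hasDerivAt_X hr.hasDerivAt_X₁ (fun x => (hC x).1) h2 x,
    norm_deriv_le hr.hasDerivAt_Y hr.hasDerivAt_Y₁ (fun x => (hC x).2) h3 x⟩⟩
  · have := (hC x).1
    have : 0 ≤ (3 * K + ‖lam‖) * C := by positivity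
    linarith
  · have := (hC x).2
    have : 0 ≤ (3 * K + ‖lam‖) * C := by positivity
    linarith

theorem exists_bound_transformed (h : IsProfile ω φ p n l)
    (hr : IsClassicalResonance n l lam X X₁ Y Y₁) :
    ∃ C, ∀ x, ‖transformedV p lam X X₁ Y x‖ ≤ C ∧ ‖transformedW p n lam X Y Y₁ x‖ ≤ C := by
  obtain ⟨C, hC⟩ := hr.exists_bound h
  obtain ⟨K, hK⟩ := h.bound
  have hC0 : 0 ≤ C := (norm_nonneg _).trans (hC 0).1
  have hK0 : 0 ≤ K := (abs_nonneg _).trans (hK 0).1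
  have b1 : ∀ {a b c a' b' c' : ℂ} {A B D : ℝ}, ‖a‖ ≤ A → ‖b‖ ≤ B → ‖c‖ ≤ D → ‖a'‖ ≤ C → ‖b'‖ ≤ C →
      ‖c'‖ ≤ C → ‖a * a' - b * b' + c * c'‖ ≤ (A + B + D) * C := by
    intro a b c a' b' c' A B D ha hb hc ha' hb' hc'
    refine (norm_add_le _ _).trans ?_
    refine (add_le_add_left (norm_sub_le _ _) _).trans ?_
    rw [norm_mul, norm_mul, norm_mul, add_mul, add_mul]
    have hA := (norm_nonneg _).trans ha
    have hB := (norm_nonneg _).trans hb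
    have hD := (norm_nonneg _).trans hc
    gcongr
  have np : ∀ x, ‖(2 : ℂ) * p x‖ ≤ 2 * K := fun x => by
    rw [norm_mul, Complex.norm_real, Real.norm_eq_abs, Complex.norm_ofNat]
    linarith [(hK x).1]
  have np2 : ∀ x, ‖(2 : ℂ) * p x ^ 2‖ ≤ 2 * K ^ 2 := fun x => by
    rw [norm_mul, norm_pow, Complex.norm_real, Real.norm_eq_abs, Complex.norm_ofNat]
    have := pow_le_pow_left₀ (abs_nonneg _) (hK x).1 2
    linarith
  have nn : ∀ x, ‖(2 : ℂ) * n x‖ ≤ 2 * K := fun x => by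
    rw [norm_mul, Complex.norm_real, Real.norm_eq_abs, Complex.norm_ofNat]
    linarith [(hK x).2.1]
  refine ⟨max ((‖lam‖ + 2 * K + 2 * K ^ 2) * C) ((‖lam‖ + 2 * K + 2 * K) * C), fun x => ⟨?_, ?_⟩⟩
  · exact (b1 (norm_neg lam).le (np x) (np2 x) (hC x).2.1 (hC x).2.2.1 (hC x).1).trans
      (le_max_left _ _)
  · exact (b1 (norm_neg lam).le (np x) (nn x) (hC x).1 (hC x).2.2.2 (hC x).2.1).trans
      (le_max_right _ _)

theorem memLp_weight_mul (h : IsProfile ω φ p n l) {a : ℝ → ℝ} (ha : Continuous a) {K : ℝ}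
    (haφ : ∀ x, |a x| ≤ K * φ x) {f : ℝ → ℂ} (hf : Continuous f) {C : ℝ} (hC : ∀ x, ‖f x‖ ≤ C) :
    MemLp (fun x => (a x : ℂ) * f x) 2 volume := by
  refine memLp_two_of_norm_le (by fun_prop) h.sq_integrable (C := K * C) fun x => ?_
  rw [norm_mul, Complex.norm_real, Real.norm_eq_abs]
  have := mul_le_mul (haφ x) (hC x) (norm_nonneg _) ((abs_nonneg _).trans (haφ x))
  linarith

theorem memLp_coeff_mul {a : ℝ → ℝ} (ha : Continuous a) {K : ℝ}
    (haK : ∀ x, |a x| ≤ K) {f : ℝ → ℂ} (hf : MemLp f 2 volume) :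
    MemLp (fun x => (a x : ℂ) * f x) 2 volume :=
  MemLp.bdd_mul_two (by fun_prop) (fun x => by
    rw [Complex.norm_real]; exact haK x) hf

/-- X and Y are only bounded, so their undifferentiated occurrences are regrouped into X'' and Y'',
which are square integrable, plus terms carrying a factor n - p² or l, which decays like φ. -/
theorem memLp_transformed_deriv (h : IsProfile ω φ p n l)
    (hr : IsClassicalResonance n l lam X X₁ Y Y₁) :
    MemLp (transformedV₁ p n lam X X₁ Y Y₁) 2 volume ∧
      MemLp (transformedW₁ p n lam X X₁ Y Y₁) 2 volume := by
  obtain ⟨C, hC⟩ := hr.bound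
  obtain ⟨K, hK⟩ := h.bound
  have hK0 : 0 ≤ K := (abs_nonneg _).trans (hK 0).1
  have hp := h.continuous_p
  have hn := h.continuous_n
  have hl := h.continuous_l
  have kp : ∀ x, |2 * p x| ≤ 2 * K := fun x => by
    rw [abs_mul, abs_two]; linarith [(hK x).1]
  have kp2 : ∀ x, |2 * p x ^ 2| ≤ 2 * K ^ 2 := fun x => by
    rw [abs_mul, abs_two, abs_pow]
    linarith [pow_le_pow_left₀ (abs_nonneg _) (hK x).1 2]
  constructor
  · have m1 := hr.memLp_Y₁.const_mul (-lam)
    have m2 := memLp_coeff_mul (a := fun x => 4 * p x ^ 2 - 2 * n x) (by fun_prop)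
      (K := 4 * K ^ 2 + 2 * K) (fun x => by
        refine (abs_sub _ _).trans ?_
        rw [abs_mul, abs_mul, abs_pow, abs_two, abs_of_pos (by norm_num : (0 : ℝ) < 4)]
        linarith [pow_le_pow_left₀ (abs_nonneg _) (hK x).1 2, (hK x).2.1]) hr.memLp_X₁
    have m3 := memLp_coeff_mul (a := fun x => 2 * p x) (by fun_prop) kp hr.memLp_X₂
    have m4 := memLp_weight_mul h (a := fun x => 4 * p x * (n x - p x ^ 2)) (by fun_prop)
      (K := 4 * K * K) (fun x => by
        rw [abs_mul, abs_mul, abs_of_pos (by norm_num : (0 : ℝ) < 4), mul_assoc (4 * K)]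
        exact mul_le_mul (by linarith [(hK x).1]) (hK x).2.2.2.2.1 (abs_nonneg _) (by positivity))
      hr.continuous_X (fun x => (hC x).1)
    refine (((m1.add m2).sub m3).add m4).ae_eq (ae_of_all _ fun x => ?_)
    simp only [transformedV₁, Pi.add_apply, Pi.sub_apply]
    push_cast
    ring
  · have m1 := hr.memLp_X₁.const_mul (-lam)
    have m2 := memLp_coeff_mul (a := fun x => 2 * p x ^ 2) (by fun_prop) kp2 hr.memLp_Y₁
    have m3 := memLp_coeff_mul (a := fun x => 2 * p x) (by fun_prop) kp hr.memLp_Y₂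
    have m4 := memLp_weight_mul h (a := fun x => 4 * p x * l x) (by fun_prop)
      (K := 4 * K * K) (fun x => by
        rw [abs_mul, abs_mul, abs_of_pos (by norm_num : (0 : ℝ) < 4), mul_assoc (4 * K)]
        exact mul_le_mul (by linarith [(hK x).1]) (hK x).2.2.2.2.2.1 (abs_nonneg _)
          (by positivity))
      hr.continuous_Y (fun x => (hC x).2)
    refine (((m1.add m2).sub m3).add m4).ae_eq (ae_of_all _ fun x => ?_)
    simp only [transformedW₁, Pi.add_apply, Pi.sub_apply]
    push_cast
    ring

/-- Away from the thresholds a resonance is square integrable. -/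
theorem IsClassicalResonance.memLp (h : IsProfile ω φ p n l)
    (hr : IsClassicalResonance n l lam X X₁ Y Y₁) (hlam : (ω : ℂ) ^ 2 - lam ^ 2 ≠ 0) :
    MemLp X 2 volume ∧ MemLp Y 2 volume := by
  obtain ⟨C, hC⟩ := hr.bound
  obtain ⟨K, hK⟩ := h.bound
  have hp := h.continuous_p
  have hn := h.continuous_n
  have hl := h.continuous_l
  -- Since n - ω and l are O(φ), the equations put ωX - λY and ωY - λX in L². This constant system
  -- has determinant ω² - λ².
  have m1 : MemLp (fun x => ω * X x - lam * Y x) 2 volume := by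
    have := hr.memLp_X₂.sub (memLp_weight_mul h (a := fun x => n x - ω) (by fun_prop)
      (fun x => (hK x).2.2.2.1) hr.continuous_X (fun x => (hC x).1))
    refine this.ae_eq (ae_of_all _ fun x => ?_)
    simp only [Pi.sub_apply]
    push_cast
    ring
  have m2 : MemLp (fun x => ω * Y x - lam * X x) 2 volume := by
    have := hr.memLp_Y₂.sub (memLp_weight_mul h (a := fun x => n x - ω + 2 * l x) (by fun_prop)
      (K := 3 * K) (fun x => by
        refine (abs_add_le _ _).trans ?_
        rw [abs_mul, abs_two]
        linarith [(hK x).2.2.2.1, (hK x).2.2.2.2.2.1]) hr.continuous_Y (fun x => (hC x).2))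
    refine this.ae_eq (ae_of_all _ fun x => ?_)
    simp only [Pi.sub_apply]
    push_cast
    ring
  constructor
  · refine (((m1.const_mul (ω : ℂ)).add (m2.const_mul lam)).const_mul
      ((ω : ℂ) ^ 2 - lam ^ 2)⁻¹).ae_eq (ae_of_all _ fun x => ?_)
    simp only [Pi.add_apply]
    field_simp
    ring
  · refine (((m2.const_mul (ω : ℂ)).add (m1.const_mul lam)).const_mul
      ((ω : ℂ) ^ 2 - lam ^ 2)⁻¹).ae_eq (ae_of_all _ fun x => ?_)
    simp only [Pi.add_apply]
    field_simp
    ring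

theorem memLp_transformed (h : IsProfile ω φ p n l)
    (hr : IsClassicalResonance n l lam X X₁ Y Y₁) (hlam : (ω : ℂ) ^ 2 - lam ^ 2 ≠ 0) :
    MemLp (transformedV p lam X X₁ Y) 2 volume ∧ MemLp (transformedW p n lam X Y Y₁) 2 volume := by
  obtain ⟨K, hK⟩ := h.bound
  obtain ⟨hX, hY⟩ := hr.memLp h hlam
  have hp := h.continuous_p
  have hn := h.continuous_n
  have kp : ∀ x, |2 * p x| ≤ 2 * K := fun x => by
    rw [abs_mul, abs_two]; linarith [(hK x).1]
  have kn : ∀ x, |2 * n x| ≤ 2 * K := fun x => by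
    rw [abs_mul, abs_two]; linarith [(hK x).2.1]
  have kp2 : ∀ x, |2 * p x ^ 2| ≤ 2 * K ^ 2 := fun x => by
    rw [abs_mul, abs_two, abs_pow]
    linarith [pow_le_pow_left₀ (abs_nonneg _) (hK x).1 2]
  constructor
  · refine (((hY.const_mul (-lam)).sub (memLp_coeff_mul (a := fun x => 2 * p x) (by fun_prop) kp
      hr.memLp_X₁)).add (memLp_coeff_mul (a := fun x => 2 * p x ^ 2) (by fun_prop) kp2
      hX)).ae_eq (ae_of_all _ fun x => ?_)
    simp only [transformedV, Pi.add_apply, Pi.sub_apply]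
    push_cast
    ring
  · refine (((hX.const_mul (-lam)).sub (memLp_coeff_mul (a := fun x => 2 * p x) (by fun_prop) kp
      hr.memLp_Y₁)).add (memLp_coeff_mul (a := fun x => 2 * n x) (by fun_prop) kn
      hY)).ae_eq (ae_of_all _ fun x => ?_)
    simp only [transformedW, Pi.add_apply, Pi.sub_apply]
    push_cast
    ring

/-- The transformation `X ↦ V` is injective on resonances with `lam ≠ 0`. -/
theorem eq_zero_of_transformedV_eq_zero (h : IsProfile ω φ p n l)
    (hr : IsClassicalResonance n l lam X X₁ Y Y₁) (hlam : lam ≠ 0)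
    (hV : ∀ x, transformedV p lam X X₁ Y x = 0) (x : ℝ) : X x = 0 ∧ Y x = 0 := by
  have hφ0 : ∀ x, (φ x : ℂ) ≠ 0 := fun x => by exact_mod_cast (h.pos x).ne'
  have hYU : ∀ x, lam * Y x = -(2 * p x * (X₁ x - p x * X x)) := fun x => by
    have := hV x
    simp only [transformedV] at this
    linear_combination -this
  -- When V = 0, U = SX satisfies U' = pU, the equation of φ, so U is a multiple of φ and Y a
  -- multiple of φ'.
  have hd : ∀ x, HasDerivAt (fun x => (X₁ x - p x * X x) / φ x) 0 x := fun x => by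
    have := ((hr.hasDerivAt_X₁ x).sub ((h.hasDerivAt_p x).ofReal_comp.mul
      (hr.hasDerivAt_X x))).div (h.hasDerivAt x).ofReal_comp (hφ0 x)
    refine this.congr_deriv ?_
    rw [div_eq_zero_iff]
    left
    simp only [Pi.sub_apply, Pi.mul_apply]
    push_cast
    linear_combination -(φ x : ℂ) * hYU x
  obtain ⟨c, hc⟩ : ∃ c : ℂ, ∀ x, X₁ x - p x * X x = c * φ x := by
    refine ⟨(X₁ 0 - p 0 * X 0) / φ 0, fun x => ?_⟩
    have := is_const_of_deriv_eq_zero (fun x => (hd x).differentiableAt) (fun x => (hd x).deriv) x 0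
    rw [← this, div_mul_cancel₀ _ (hφ0 x)]
  have hY : ∀ x, Y x = -(2 * c / lam) * (p x * φ x) := fun x => by
    have := hYU x
    rw [hc] at this
    field_simp
    linear_combination this
  have hd1 : ∀ x, HasDerivAt Y (-(2 * c / lam) * (n x * φ x)) x := fun x => by
    have := ((h.hasDerivAt_p x).mul (h.hasDerivAt x)).ofReal_comp.const_mul (-(2 * c / lam))
    have e : Y = fun x => -(2 * c / lam) * ((p x * φ x : ℝ) : ℂ) := funext fun x => by
      rw [hY]; push_cast; ring
    rw [e]
    refine this.congr_deriv ?_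
    push_cast
    ring
  have hY₁ : ∀ x, Y₁ x = -(2 * c / lam) * (n x * φ x) := fun x => (hr.hasDerivAt_Y x).unique (hd1 x)
  -- L₊φ' = 0, hence L₊Y = 0; comparison with L₊Y = λX gives X = 0.
  have hd2 : ∀ x, HasDerivAt Y₁ ((n x + 2 * l x) * Y x) x := fun x => by
    have := ((h.hasDerivAt_n x).mul (h.hasDerivAt x)).ofReal_comp.const_mul (-(2 * c / lam))
    have e : Y₁ = fun x => -(2 * c / lam) * ((n x * φ x : ℝ) : ℂ) := funext fun x => by
      rw [hY₁]; push_cast; ring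
    rw [e, hY]
    refine this.congr_deriv ?_
    push_cast
    ring
  have hX : ∀ x, X x = 0 := fun x => by
    have := (hr.hasDerivAt_Y₁ x).unique (hd2 x)
    have h2 : lam * X x = 0 := by linear_combination -this
    exact (mul_eq_zero.1 h2).resolve_left hlam
  have hX₁ : ∀ x, X₁ x = 0 := fun x => by
    have h1 := hr.hasDerivAt_X x
    rw [show X = fun _ => 0 from funext hX] at h1
    exact h1.unique (hasDerivAt_const x 0)
  refine ⟨hX x, ?_⟩
  have := hYU x
  rw [hX, hX₁] at this
  have h2 : lam * Y x = 0 := by linear_combination this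
  exact (mul_eq_zero.1 h2).resolve_left hlam

variable {k ε : ℝ} {b₁ q₁ β ι : ℝ → ℝ}

/-- The coefficients and mu are real, so the real and imaginary parts of V ± W each solve the
repulsive system. Up to and including the threshold k² boundedness is enough; beyond it square
integrability is available. -/
theorem eq_zero_of_pos (h : IsProfile (k ^ 2) φ p n l)
    (hb : RepulsiveCoefficients k ε φ (fun x => 4 * p x ^ 2 - 3 * n x + l x - k ^ 2) b₁
      (fun x => 2 * p x ^ 2 - 2 * n x + l x) q₁ β ι)
    {mu : ℝ} (hmu : 0 < mu) (hr : IsClassicalResonance n l mu X X₁ Y Y₁) (x : ℝ) :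
    transformedV p mu X X₁ Y x = 0 := by
  have hV := hasDerivAt_transformedV h hr
  have hW := hasDerivAt_transformedW h hr
  have hV₁ := hasDerivAt_transformedV₁ h hr
  have hW₁ := hasDerivAt_transformedW₁ h hr
  obtain ⟨hV₁i, hW₁i⟩ := memLp_transformed_deriv h hr
  have hP := fun x => (hV x).add (hW x)
  have hD := fun x => (hV x).sub (hW x)
  have hP₁i := hV₁i.add hW₁i
  have hD₁i := hV₁i.sub hW₁i
  set V := transformedV p mu X X₁ Y
  set W := transformedW p n mu X Y Y₁
  set V₁ := transformedV₁ p n mu X X₁ Y Y₁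
  set W₁ := transformedW₁ p n mu X X₁ Y Y₁
  have hP₁ : ∀ x, HasDerivAt (V₁ + W₁) (((k ^ 2 - mu +
      (4 * p x ^ 2 - 3 * n x + l x - k ^ 2) : ℝ) : ℂ) * (V + W) x +
      ((2 * p x ^ 2 - 2 * n x + l x : ℝ) : ℂ) * (V - W) x) x := fun x => by
    refine ((hV₁ x).add (hW₁ x)).congr_deriv ?_
    simp only [Pi.add_apply, Pi.sub_apply]
    push_cast
    ring
  have hD₁ : ∀ x, HasDerivAt (V₁ - W₁) (((k ^ 2 + mu +
      (4 * p x ^ 2 - 3 * n x + l x - k ^ 2) : ℝ) : ℂ) * (V - W) x +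
      ((2 * p x ^ 2 - 2 * n x + l x : ℝ) : ℂ) * (V + W) x) x := fun x => by
    refine ((hV₁ x).sub (hW₁ x)).congr_deriv ?_
    simp only [Pi.add_apply, Pi.sub_apply]
    push_cast
    ring
  have key : (V + W) x = 0 ∧ (V - W) x = 0 := by
    have hP₁r := fun x => HasDerivAt.re_comp (hP₁ x)
    have hP₁m := fun x => HasDerivAt.im_comp (hP₁ x)
    have hD₁r := fun x => HasDerivAt.re_comp (hD₁ x)
    have hD₁m := fun x => HasDerivAt.im_comp (hD₁ x)
    simp only [Complex.add_re, Complex.add_im, Complex.re_ofReal_mul, Complex.im_ofReal_mul]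
      at hP₁r hP₁m hD₁r hD₁m
    suffices hs : (((V + W) x).re = 0 ∧ ((V - W) x).re = 0) ∧
        (((V + W) x).im = 0 ∧ ((V - W) x).im = 0) from
      ⟨Complex.ext hs.1.1 hs.2.1, Complex.ext hs.1.2 hs.2.2⟩
    rcases le_or_gt mu (k ^ 2) with hle | hlt
    · obtain ⟨C, hC⟩ := exists_bound_transformed h hr
      have hPC : ∀ x, ‖(V + W) x‖ ≤ C + C := fun x =>
        (norm_add_le _ _).trans (add_le_add (hC x).1 (hC x).2)
      have hDC : ∀ x, ‖(V - W) x‖ ≤ C + C := fun x =>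
        (norm_sub_le _ _).trans (add_le_add (hC x).1 (hC x).2)
      exact ⟨hb.eq_zero_of_le hmu hle (fun x => HasDerivAt.re_comp (hP x))
          (fun x => HasDerivAt.re_comp (hD x)) hP₁r hD₁r
          (fun x => (Complex.abs_re_le_norm _).trans (hPC x))
          (fun x => (Complex.abs_re_le_norm _).trans (hDC x))
          (MemLp.integrable_sq_re hP₁i) (MemLp.integrable_sq_re hD₁i) x,
        hb.eq_zero_of_le hmu hle (fun x => HasDerivAt.im_comp (hP x))
          (fun x => HasDerivAt.im_comp (hD x)) hP₁m hD₁m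
          (fun x => (Complex.abs_im_le_norm _).trans (hPC x))
          (fun x => (Complex.abs_im_le_norm _).trans (hDC x))
          (MemLp.integrable_sq_im hP₁i) (MemLp.integrable_sq_im hD₁i) x⟩
    · obtain ⟨hVi, hWi⟩ := memLp_transformed h hr (by
        have : (k ^ 2) ^ 2 - mu ^ 2 < 0 := by
          have := pow_lt_pow_left₀ hlt (sq_nonneg k) two_ne_zero
          linarith
        exact_mod_cast this.ne)
      have hPi := hVi.add hWi
      have hDi := hVi.sub hWi
      exact ⟨hb.eq_zero_of_lt hlt (fun x => HasDerivAt.re_comp (hP x))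
          (fun x => HasDerivAt.re_comp (hD x)) hP₁r hD₁r
          (MemLp.integrable_sq_re hPi) (MemLp.integrable_sq_re hDi)
          (MemLp.integrable_sq_re hP₁i) (MemLp.integrable_sq_re hD₁i) x,
        hb.eq_zero_of_lt hlt (fun x => HasDerivAt.im_comp (hP x))
          (fun x => HasDerivAt.im_comp (hD x)) hP₁m hD₁m
          (MemLp.integrable_sq_im hPi) (MemLp.integrable_sq_im hDi)
          (MemLp.integrable_sq_im hP₁i) (MemLp.integrable_sq_im hD₁i) x⟩
  have h1 := key.1
  have h2 := key.2
  simp only [Pi.add_apply, Pi.sub_apply] at h1 h2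
  linear_combination (h1 + h2) / 2

theorem IsClassicalResonance.eq_zero (h : IsProfile (k ^ 2) φ p n l)
    (hb : RepulsiveCoefficients k ε φ (fun x => 4 * p x ^ 2 - 3 * n x + l x - k ^ 2) b₁
      (fun x => 2 * p x ^ 2 - 2 * n x + l x) q₁ β ι)
    (hr : IsClassicalResonance n l lam X X₁ Y Y₁) (hlam : lam ≠ 0) (x : ℝ) :
    X x = 0 ∧ Y x = 0 := by
  by_cases him : lam.im = 0
  · obtain ⟨mu, rfl⟩ : ∃ mu : ℝ, lam = mu := ⟨lam.re, Complex.ext rfl him⟩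
    rcases lt_trichotomy mu 0 with hmu | hmu | hmu
    -- The symmetry (X, Y, λ) ↦ (-X, Y, -λ) reduces to positive parameters.
    · have hr' : IsClassicalResonance n l ((-mu : ℝ) : ℂ) (-X) (-X₁) Y Y₁ := by
        rw [Complex.ofReal_neg]; exact hr.neg
      have := eq_zero_of_transformedV_eq_zero h hr' (by simpa using hlam)
        (eq_zero_of_pos h hb (neg_pos.2 hmu) hr') x
      exact ⟨neg_eq_zero.1 this.1, this.2⟩
    · exact absurd (by rw [hmu]; rfl) hlam
    · exact eq_zero_of_transformedV_eq_zero h hr hlam (eq_zero_of_pos h hb hmu hr) x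
  · refine eq_zero_of_transformedV_eq_zero h hr hlam (fun x => ?_) x
    obtain ⟨C, hC⟩ := exists_bound_transformed h hr
    obtain ⟨hV₁i, hW₁i⟩ := memLp_transformed_deriv h hr
    -- The two potentials are k² + b + q and k² + b - q, with |b| and |q| at most k²/4.
    have hk : 0 < k ^ 2 / 2 := by have := hb.k_pos; positivity
    refine (eq_zero_of_im_ne_zero hk (fun x => ?_) (fun x => ?_) him
      (hasDerivAt_transformedV h hr) (hasDerivAt_transformedW h hr)
      (hasDerivAt_transformedV₁ h hr) (hasDerivAt_transformedW₁ h hr)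
      (fun x => (hC x).1) (fun x => (hC x).2)
      ((memLp_two_iff_integrable_sq_norm hV₁i.aestronglyMeasurable).1 hV₁i)
      ((memLp_two_iff_integrable_sq_norm hW₁i.aestronglyMeasurable).1 hW₁i) x).1
    · have h1 := abs_le.1 (hb.abs_b_le x)
      have h2 := abs_le.1 (hb.abs_q_le' x)
      linarith
    · have h1 := abs_le.1 (hb.abs_b_le x)
      have h2 := abs_le.1 (hb.abs_q_le' x)
      linarith

/-- The Wronskian of a bounded solution with square integrable derivative and a decaying solution
vanishes. -/
theorem wronskian_eq_zero {v f f₁ : ℝ → ℝ} {u u₁ : ℝ → ℂ}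
    (hu : ∀ x, HasDerivAt u (u₁ x) x) (hu₁ : ∀ x, HasDerivAt u₁ (v x * u x) x)
    (hf : ∀ x, HasDerivAt f (f₁ x) x) (hf₁ : ∀ x, HasDerivAt f₁ (v x * f x) x)
    {C : ℝ} (hC : ∀ x, ‖u x‖ ≤ C) (hu₁i : MemLp u₁ 2 volume) {K : ℝ} (hK : ∀ x, |f x| ≤ K)
    (hf₁i : Integrable fun x => f₁ x ^ 2) (x : ℝ) : u₁ x * f x - u x * f₁ x = 0 := by
  have hd : ∀ x, HasDerivAt (fun x => u₁ x * f x - u x * f₁ x) 0 x := fun x => by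
    refine (((hu₁ x).mul (hf x).ofReal_comp).sub ((hu x).mul (hf₁ x).ofReal_comp)).congr_deriv ?_
    push_cast
    ring
  have hconst := fun y => is_const_of_deriv_eq_zero (fun x => (hd x).differentiableAt)
    (fun x => (hd x).deriv) y x
  have m1 : MemLp (fun x => (f x : ℂ) * u₁ x) 2 volume :=
    memLp_coeff_mul (continuous_of_hasDerivAt hf) hK hu₁i
  have hf₁c := continuous_of_hasDerivAt hf₁
  have m2 : MemLp (fun x => u x * (f₁ x : ℂ)) 2 volume :=
    MemLp.bdd_mul_two (continuous_of_hasDerivAt hu) hC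
      (memLp_two_of_norm_le (by fun_prop) (φ := fun x => |f₁ x|) (C := 1) (by simpa using hf₁i)
        (fun x => by simp))
  -- The Wronskian is constant and belongs to L²(ℝ), hence vanishes.
  have m3 := (m1.sub m2).ae_eq (g := fun _ => u₁ x * f x - u x * f₁ x) (ae_of_all _ fun y => by
    rw [← hconst y]
    simp only [Pi.sub_apply]
    ring)
  rw [memLp_const_iff two_ne_zero ENNReal.ofNat_ne_top] at m3
  simpa using m3

/-- Vanishing of the Wronskian with φ > 0 makes X/φ constant. Since φ' has a zero, Y is instead
compared with a multiple of φ' through Cauchy data at the origin, where φ''(0) ≠ 0. -/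
theorem IsClassicalResonance.of_eq_zero (h : IsProfile ω φ p n l)
    (hr : IsClassicalResonance n l 0 X X₁ Y Y₁) :
    (∃ c : ℂ, ∀ x, X x = c * φ x) ∧ ∃ c : ℂ, ∀ x, Y x = c * ((p x * φ x : ℝ) : ℂ) := by
  obtain ⟨C, hC⟩ := hr.bound
  obtain ⟨K, hK⟩ := h.bound
  have hφ0 : ∀ x, (φ x : ℂ) ≠ 0 := fun x => by exact_mod_cast (h.pos x).ne'
  have hX₁ : ∀ x, HasDerivAt X₁ (n x * X x) x := fun x => by
    simpa using hr.hasDerivAt_X₁ x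
  have hY₁ : ∀ x, HasDerivAt Y₁ (((n x + 2 * l x : ℝ) : ℂ) * Y x) x := fun x => by
    simpa using hr.hasDerivAt_Y₁ x
  have hφ₁ : ∀ x, HasDerivAt (fun x => p x * φ x) (n x * φ x) x := fun x => by
    refine ((h.hasDerivAt_p x).mul (h.hasDerivAt x)).congr_deriv ?_
    ring
  have hφ₂ : ∀ x, HasDerivAt (fun x => n x * φ x) ((n x + 2 * l x) * (p x * φ x)) x := fun x => by
    refine ((h.hasDerivAt_n x).mul (h.hasDerivAt x)).congr_deriv ?_
    ring
  have hint : ∀ a : ℝ → ℝ, Continuous a → (∀ x, |a x| ≤ K) →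
      Integrable fun x => (a x * φ x) ^ 2 := fun a ha haK => by
    have := h.continuous
    refine (h.sq_integrable.const_mul (K ^ 2)).mono' (by fun_prop) (ae_of_all _ fun x => ?_)
    rw [Real.norm_eq_abs, abs_of_nonneg (sq_nonneg _), mul_pow]
    have := sq_le_sq' (abs_le.1 (haK x)).1 (abs_le.1 (haK x)).2
    gcongr
  have wX := wronskian_eq_zero hr.hasDerivAt_X hX₁ h.hasDerivAt hφ₁ (fun x => (hC x).1)
    hr.memLp_X₁ (fun x => by rw [abs_of_pos (h.pos x)]; exact (hK x).2.2.2.2.2.2)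
    (hint p h.continuous_p fun x => (hK x).1)
  have wY := wronskian_eq_zero hr.hasDerivAt_Y hY₁ hφ₁ hφ₂ (fun x => (hC x).2)
    hr.memLp_Y₁ (K := K * K) (fun x => by
      rw [abs_mul]
      exact mul_le_mul (hK x).1 (by rw [abs_of_pos (h.pos x)]; exact (hK x).2.2.2.2.2.2)
        (abs_nonneg _) ((abs_nonneg _).trans (hK x).1))
    (hint n h.continuous_n fun x => (hK x).2.1)
  constructor
  · refine ⟨X 0 / φ 0, fun x => ?_⟩
    have hd : ∀ x, HasDerivAt (fun x => X x / φ x) 0 x := fun x => by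
      refine ((hr.hasDerivAt_X x).div (h.hasDerivAt x).ofReal_comp (hφ0 x)).congr_deriv ?_
      rw [div_eq_zero_iff]
      exact Or.inl (wX x)
    have := is_const_of_deriv_eq_zero (fun x => (hd x).differentiableAt) (fun x => (hd x).deriv) x 0
    rw [← this, div_mul_cancel₀ _ (hφ0 x)]
  · have hn0 : (n 0 : ℂ) * φ 0 ≠ 0 := mul_ne_zero (by exact_mod_cast h.n_zero) (hφ0 0)
    have hY0 : Y 0 = 0 := by
      have := wY 0
      rw [h.p_zero] at this
      have h2 : Y 0 * ((n 0 : ℂ) * φ 0) = 0 := by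
        push_cast at this
        linear_combination -this
      exact (mul_eq_zero.1 h2).resolve_right hn0
    refine ⟨Y₁ 0 / (n 0 * φ 0), fun x => ?_⟩
    set c := Y₁ 0 / ((n 0 : ℂ) * φ 0) with hc
    have hnc := h.continuous_n
    have hlc := h.continuous_l
    refine sub_eq_zero.1 (eq_zero_of_linear_ode (q := fun x => ((n x + 2 * l x : ℝ) : ℂ))
      (u := fun x => Y x - c * ((p x * φ x : ℝ) : ℂ))
      (u₁ := fun x => Y₁ x - c * ((n x * φ x : ℝ) : ℂ)) (x₀ := 0) (by fun_prop)
      (fun x => (hr.hasDerivAt_Y x).sub ((hφ₁ x).ofReal_comp.const_mul c))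
      (fun x => ?_) ?_ ?_ x)
    · refine ((hY₁ x).sub ((hφ₂ x).ofReal_comp.const_mul c)).congr_deriv ?_
      push_cast
      ring
    · simp [hY0, h.p_zero]
    · simp only [hc]
      push_cast
      rw [div_mul_cancel₀ _ hn0, sub_self]

end NLS

/-! ### Coefficients of the transformed system -/

namespace NLS

/-- A profile decaying at infinity, close to the cubic soliton, such that the coefficients of the
transformed system are of size `ε` with `∫ b ≥ 20000 ε² k`. -/
structure IsNearCubic (k ε : ℝ) (φ p n l b₁ q₁ : ℝ → ℝ) : Prop extends
    IsProfile (k ^ 2) φ p n l where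
  k_pos : 0 < k
  ε_pos : 0 < ε
  ε_le : ε ≤ 1 / 1000
  even : ∀ x, φ (-x) = φ x
  tendsto_atTop : Tendsto φ atTop (𝓝 0)
  tendsto_atBot : Tendsto φ atBot (𝓝 0)
  sq_le : ∀ x, φ x ^ 2 ≤ 3 * k ^ 2
  le_deriv : ∀ x, 2 / 5 * φ x ^ 2 ≤ p x ^ 2 - n x
  deriv_le : ∀ x, p x ^ 2 - n x ≤ 3 / 5 * φ x ^ 2
  p_sq_le : ∀ x, p x ^ 2 ≤ k ^ 2
  le_p_sq : ∀ x, k ^ 2 - p x ^ 2 ≤ 11 / 20 * φ x ^ 2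
  abs_b : ∀ x, |4 * p x ^ 2 - 3 * n x + l x - k ^ 2| ≤ 3 * ε * φ x ^ 2
  abs_q : ∀ x, |2 * p x ^ 2 - 2 * n x + l x| ≤ 3 * ε * φ x ^ 2
  hasDerivAt_b : ∀ x, HasDerivAt (fun x => 4 * p x ^ 2 - 3 * n x + l x - k ^ 2) (b₁ x) x
  hasDerivAt_q : ∀ x, HasDerivAt (fun x => 2 * p x ^ 2 - 2 * n x + l x) (q₁ x) x
  abs_b₁ : ∀ x, |b₁ x| ≤ 10 * ε * k * φ x ^ 2
  abs_q₁ : ∀ x, |q₁ x| ≤ 10 * ε * k * φ x ^ 2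
  le_integral : 20000 * ε ^ 2 * k ≤ ∫ x, (4 * p x ^ 2 - 3 * n x + l x - k ^ 2)

namespace IsNearCubic

variable {k ε : ℝ} {φ p n l b₁ q₁ : ℝ → ℝ}

theorem le_two_mul (h : IsNearCubic k ε φ p n l b₁ q₁) (x : ℝ) : φ x ≤ 2 * k := by
  have := h.k_pos
  refine le_of_sq_le_sq ?_ (by positivity)
  nlinarith [h.sq_le x, sq_nonneg k]

theorem antitone_p (h : IsNearCubic k ε φ p n l b₁ q₁) : Antitone p := by
  refine antitone_of_hasDerivAt_nonpos h.hasDerivAt_p fun x => ?_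
  have := h.le_deriv x
  have := sq_nonneg (φ x)
  simp only [Pi.zero_apply]
  linarith

theorem tendsto_sqrt (h : IsNearCubic k ε φ p n l b₁ q₁) {F : Filter ℝ}
    (hF : Tendsto φ F (𝓝 0)) : Tendsto (fun x => |p x|) F (𝓝 k) := by
  have h1 : Tendsto (fun x => k ^ 2 - p x ^ 2) F (𝓝 0) := by
    refine squeeze_zero (fun x => sub_nonneg.2 (h.p_sq_le x)) h.le_p_sq ?_
    simpa using (hF.pow 2).const_mul (11 / 20)
  have h2 : Tendsto (fun x => √(p x ^ 2)) F (𝓝 (√(k ^ 2))) := by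
    refine (Real.continuous_sqrt.tendsto _).comp ?_
    have h3 := h1.const_sub (k ^ 2)
    rw [sub_zero] at h3
    exact h3.congr fun x => by ring
  simpa [Real.sqrt_sq_eq_abs, abs_of_pos h.k_pos] using h2

theorem tendsto_p_atTop (h : IsNearCubic k ε φ p n l b₁ q₁) : Tendsto p atTop (𝓝 (-k)) := by
  refine ((h.tendsto_sqrt h.tendsto_atTop).neg).congr' ?_
  filter_upwards [eventually_ge_atTop 0] with x hx
  rw [abs_of_nonpos ((h.antitone_p hx).trans_eq h.p_zero), neg_neg]

theorem tendsto_p_atBot (h : IsNearCubic k ε φ p n l b₁ q₁) : Tendsto p atBot (𝓝 k) := by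
  refine (h.tendsto_sqrt h.tendsto_atBot).congr' ?_
  filter_upwards [eventually_le_atBot 0] with x hx
  rw [abs_of_nonneg (h.p_zero.symm.trans_le (h.antitone_p hx))]

/-- Convexity of 1/φ: its second derivative (2p² - n)/φ is at least k/4 and its slope at 0 vanishes,
so 1/φ ≥ 1/(2k) + kx²/8 ≥ |x|/2, the last step by the arithmetic-geometric inequality. -/
theorem mul_le_two (h : IsNearCubic k ε φ p n l b₁ q₁) (x : ℝ) : |x| * φ x ≤ 2 := by
  have hk := h.k_pos
  suffices H : ∀ x, 0 ≤ x → x * φ x ≤ 2 by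
    rcases le_total 0 x with hx | hx
    · rw [abs_of_nonneg hx]; exact H x hx
    · rw [abs_of_nonpos hx, ← h.even]; exact H _ (by linarith)
  have hΘ : ∀ x, HasDerivAt (fun x => (φ x)⁻¹) (-p x / φ x) x := fun x => by
    refine ((h.hasDerivAt x).inv (h.pos x).ne').congr_deriv ?_
    have := (h.pos x).ne'
    field_simp
  have hT : ∀ x, HasDerivAt (fun x => -p x / φ x) ((2 * p x ^ 2 - n x) / φ x) x := fun x => by
    refine ((h.hasDerivAt_p x).neg.div (h.hasDerivAt x) (h.pos x).ne').congr_deriv ?_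
    have := (h.pos x).ne'
    simp only [Pi.neg_apply]
    field_simp
    ring
  have low : ∀ x, k / 4 ≤ (2 * p x ^ 2 - n x) / φ x := fun x => by
    rw [le_div_iff₀ (h.pos x)]
    nlinarith [h.le_two_mul x, h.le_p_sq x, h.le_deriv x, h.sq_le x, h.pos x]
  have m1 : Monotone fun x => -p x / φ x - k / 4 * x :=
    monotone_of_hasDerivAt_nonneg
      (fun x => ((hT x).sub ((hasDerivAt_id x).const_mul (k / 4))))
      (fun x => by simpa using low x)
  have m1' : ∀ x, 0 ≤ x → k / 4 * x ≤ -p x / φ x := fun x hx => by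
    have := m1 hx
    simp only [h.p_zero] at this
    simp at this
    linarith
  have hd : ∀ x, HasDerivAt (fun x => (φ x)⁻¹ - k / 8 * x ^ 2) (-p x / φ x - k / 4 * x) x := by
    intro x
    refine ((hΘ x).sub (((hasDerivAt_id x).pow 2).const_mul (k / 8))).congr_deriv ?_
    simp
    ring
  have m2 : MonotoneOn (fun x => (φ x)⁻¹ - k / 8 * x ^ 2) (Ici 0) := by
    refine monotoneOn_of_deriv_nonneg (convex_Ici 0)
      (continuous_of_hasDerivAt hd).continuousOn
      (fun x _ => (hd x).differentiableAt.differentiableWithinAt) fun x hx => ?_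
    rw [(hd x).deriv]
    rw [interior_Ici] at hx
    have := m1' x (le_of_lt hx)
    linarith
  intro x hx
  have h1 := m2 self_mem_Ici hx hx
  have h2 : 1 / (2 * k) ≤ (φ 0)⁻¹ := by
    rw [one_div]
    exact inv_anti₀ (h.pos 0) (h.le_two_mul 0)
  have h3 : x / 2 ≤ (φ x)⁻¹ := by
    have h4 : x / 2 ≤ 1 / (2 * k) + k / 8 * x ^ 2 := by
      have : 1 / (2 * k) + k / 8 * x ^ 2 - x / 2 = (k * x - 2) ^ 2 / (8 * k) := by
        field_simp
        ring
      have : 0 ≤ (k * x - 2) ^ 2 / (8 * k) := by positivity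
      linarith
    simp only at h1
    nlinarith
  have h5 := mul_le_mul_of_nonneg_right h3 (h.pos x).le
  rw [inv_mul_cancel₀ (h.pos x).ne'] at h5
  linarith

theorem abs_mul_le (h : IsNearCubic k ε φ p n l b₁ q₁) {x a c : ℝ} (hc : 0 ≤ c)
    (ha : |a| ≤ c * φ x ^ 2) : |x * a| ≤ 2 * c * φ x := by
  rw [abs_mul]
  have h1 := mul_le_mul_of_nonneg_left ha (abs_nonneg x)
  have h2 := mul_le_mul_of_nonneg_left (h.mul_le_two x) (mul_nonneg hc (h.pos x).le)
  nlinarith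

/-- Since p² - n = -p' is positive with integral 2k, the function ι = I/(2k) (p² - n) carries the
whole integral I of b. The remainder b - ι has mean zero, and its primitive β vanishes at both ends.
-/
theorem repulsiveCoefficients (h : IsNearCubic k ε φ p n l b₁ q₁) :
    ∃ β ι, RepulsiveCoefficients k ε φ (fun x => 4 * p x ^ 2 - 3 * n x + l x - k ^ 2) b₁
      (fun x => 2 * p x ^ 2 - 2 * n x + l x) q₁ β ι := by
  have hk := h.k_pos
  have hε := h.ε_pos
  set b : ℝ → ℝ := fun x => 4 * p x ^ 2 - 3 * n x + l x - k ^ 2 with hb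
  have hbc : Continuous b := continuous_of_hasDerivAt h.hasDerivAt_b
  have hpc := h.continuous_p
  have hnc := h.continuous_n
  have hbi : Integrable b := (h.sq_integrable.const_mul (3 * ε)).mono' hbc.aestronglyMeasurable
    (ae_of_all _ h.abs_b)
  have hd0 : ∀ x, 0 ≤ p x ^ 2 - n x := fun x => le_trans (by positivity) (h.le_deriv x)
  have hdi : Integrable fun x => p x ^ 2 - n x :=
    (h.sq_integrable.const_mul (3 / 5)).mono' (by fun_prop) (ae_of_all _ fun x => by
      rw [Real.norm_eq_abs, abs_of_nonneg (hd0 x)]; exact h.deriv_le x)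
  have hint : ∫ x, (p x ^ 2 - n x) = 2 * k := by
    have := integral_of_hasDerivAt_of_tendsto (f := fun x => -p x) (f' := fun x => p x ^ 2 - n x)
      (fun x => (h.hasDerivAt_p x).neg.congr_deriv (by ring)) hdi h.tendsto_p_atBot.neg
      h.tendsto_p_atTop.neg
    rw [this]
    ring
  have hbd : ∀ x, |b x| ≤ 15 / 2 * ε * (p x ^ 2 - n x) := fun x => by
    have h1 := h.abs_b x
    have h2 := mul_le_mul_of_nonneg_left (h.le_deriv x) hε.le
    nlinarith
  set I : ℝ := ∫ x, b x with hI
  have hI2 : |I| ≤ 15 * ε * k := by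
    have h1 : ‖I‖ ≤ ∫ x, 15 / 2 * ε * (p x ^ 2 - n x) :=
      norm_integral_le_of_norm_le (hdi.const_mul _) (ae_of_all _ hbd)
    rw [integral_const_mul, hint, Real.norm_eq_abs] at h1
    linarith
  have hI1 : 20000 * ε ^ 2 * k ≤ I := h.le_integral
  set β : ℝ → ℝ := fun x => (∫ t in Iic x, b t) + I / (2 * k) * (p x - k) with hβ
  set ι : ℝ → ℝ := fun x => I / (2 * k) * (p x ^ 2 - n x) with hι
  have hβd : ∀ x, HasDerivAt β (b x - ι x) x := fun x => by
    refine ((hasDerivAt_integral_Iic hbc hbi x).add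
      (((h.hasDerivAt_p x).sub_const k).const_mul (I / (2 * k)))).congr_deriv ?_
    simp only [hι]
    ring
  have hβtop : Tendsto β atTop (𝓝 0) := by
    have h1 : Tendsto (fun x => ∫ t in Iic x, b t) atTop (𝓝 I) := by
      have := (intervalIntegral_tendsto_integral_Ioi 0 hbi.integrableOn tendsto_id).const_add
        (∫ t in Iic (0 : ℝ), b t)
      rw [intervalIntegral.integral_Iic_add_Ioi hbi.integrableOn hbi.integrableOn] at this
      exact this.congr fun x => (integral_Iic_eq_add hbi x).symm
    have := h1.add ((h.tendsto_p_atTop.sub_const k).const_mul (I / (2 * k)))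
    convert this using 2
    field_simp
    ring
  have hβbot : Tendsto β atBot (𝓝 0) := by
    have h1 : Tendsto (fun x => ∫ t in Iic x, b t) atBot (𝓝 0) := by
      have := (intervalIntegral_tendsto_integral_Iic 0 hbi.integrableOn tendsto_id).const_sub
        (∫ t in Iic (0 : ℝ), b t)
      rw [sub_self] at this
      refine this.congr fun x => ?_
      rw [integral_Iic_eq_add hbi x, intervalIntegral.integral_symm]
      simp
    have := h1.add ((h.tendsto_p_atBot.sub_const k).const_mul (I / (2 * k)))
    simpa using this
  have hβ' : ∀ x, |b x - ι x| ≤ 15 * ε * (p x ^ 2 - n x) := fun x => by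
    have h1 : |ι x| ≤ 15 / 2 * ε * (p x ^ 2 - n x) := by
      simp only [hι]
      rw [abs_mul, abs_of_nonneg (hd0 x), abs_div, abs_of_pos (by linarith : 0 < 2 * k)]
      refine mul_le_mul_of_nonneg_right ?_ (hd0 x)
      rw [div_le_iff₀ (by linarith)]
      linarith
    have h2 := abs_sub (b x) (ι x)
    have h3 := hbd x
    linarith
  have a1 : Antitone fun x => 15 * ε * p x + β x :=
    antitone_of_hasDerivAt_nonpos
      (fun x => ((h.hasDerivAt_p x).const_mul (15 * ε)).add (hβd x)) fun x => by
        simp only [Pi.zero_apply]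
        linarith [(abs_le.1 (hβ' x)).2]
  have a2 : Antitone fun x => 15 * ε * p x - β x :=
    antitone_of_hasDerivAt_nonpos
      (fun x => ((h.hasDerivAt_p x).const_mul (15 * ε)).sub (hβd x)) fun x => by
        simp only [Pi.zero_apply]
        linarith [(abs_le.1 (hβ' x)).1]
  -- From |β'| ≤ -15εp', both 15εp ± β decrease; their limits ±15εk at the two ends confine β.
  have hβb : ∀ x, |β x| ≤ 15 * ε * (k - |p x|) := fun x => by
    have c1 := a1.le_of_tendsto ((h.tendsto_p_atTop.const_mul (15 * ε)).add hβtop) x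
    have c2 := a2.le_of_tendsto ((h.tendsto_p_atTop.const_mul (15 * ε)).sub hβtop) x
    have c3 := a1.ge_of_tendsto ((h.tendsto_p_atBot.const_mul (15 * ε)).add hβbot) x
    have c4 := a2.ge_of_tendsto ((h.tendsto_p_atBot.const_mul (15 * ε)).sub hβbot) x
    rcases abs_cases (p x) with ⟨hp, _⟩ | ⟨hp, _⟩ <;> rw [hp, abs_le] <;>
      constructor <;> linarith
  refine ⟨β, ι, ⟨hk, hε, h.ε_le, h.pos, h.le_two_mul, h.sq_integrable, h.hasDerivAt_b,
    h.hasDerivAt_q, hβd, fun x => ?_, h.abs_b, h.abs_q, fun x => ?_, fun x => ?_, fun x => ?_,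
    fun x => ?_⟩⟩
  · simp only [hι]
    have h1 : 10000 * ε ^ 2 ≤ I / (2 * k) := by
      rw [le_div_iff₀ (by linarith)]
      linarith
    have h2 := mul_le_mul h1 (h.le_deriv x) (by positivity) (le_trans (by positivity) h1)
    linarith
  · refine (hβb x).trans ?_
    -- Factor k² - p² = (k - |p|)(k + |p|) and drop |p| from the second factor.
    have h1 : k * (k - |p x|) ≤ 11 / 20 * φ x ^ 2 := by
      have := h.le_p_sq x
      rw [← sq_abs (p x)] at this
      have h2 : |p x| ≤ k := abs_le_of_sq_le_sq (h.p_sq_le x) hk.le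
      nlinarith [abs_nonneg (p x)]
    have h3 : k * (k - |p x|) ≤ k * (11 / 10 * φ x) := by
      nlinarith [h.le_two_mul x, h.pos x]
    have h4 := le_of_mul_le_mul_left h3 hk
    have h5 := mul_le_mul_of_nonneg_left h4 hε.le
    have := mul_pos hε (h.pos x)
    linarith
  · refine (h.abs_mul_le (c := 3 * ε) (by positivity) (h.abs_b x)).trans_eq ?_
    ring
  · refine (h.abs_mul_le (c := 10 * ε * k) (by positivity) (h.abs_b₁ x)).trans_eq ?_
    ring
  · refine (h.abs_mul_le (c := 10 * ε * k) (by positivity) (h.abs_q₁ x)).trans_eq ?_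
    ring

end IsNearCubic

end NLS

/-! ### The nonlinearity near zero and solitary waves -/

namespace NLS

variable {g : ℝ → ℝ}

theorem HypothesisH1.hasDerivAt (h : HypothesisH1 g) {s : ℝ} (hs : 0 < s) :
    HasDerivAt g (deriv g s) s :=
  ((h.contDiffOn_five.differentiableOn (by norm_num)).differentiableAt
    (Ioi_mem_nhds hs)).hasDerivAt

theorem HypothesisH1.hasDerivAt_deriv (h : HypothesisH1 g) {s : ℝ} (hs : 0 < s) :
    HasDerivAt (deriv g) (iteratedDeriv 2 g s) s := by
  have h1 : ContDiffOn ℝ 4 (deriv g) (Ioi 0) :=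
    (contDiffOn_succ_iff_deriv_of_isOpen (n := 4) isOpen_Ioi).1
      (h.contDiffOn_five.of_le (by norm_num)) |>.2.2
  have := ((h1.differentiableOn (by norm_num)).differentiableAt (Ioi_mem_nhds hs)).hasDerivAt
  rwa [iteratedDeriv_succ, iteratedDeriv_one]

theorem HypothesisH1.continuousOn (h : HypothesisH1 g) : ContinuousOn g (Ici 0) :=
  h.contDiffOn_one.continuousOn

/-- Near `0` the nonlinearity `g` is small together with its first two derivatives. -/
theorem HypothesisH1.exists_bounds (h : HypothesisH1 g) {η : ℝ} (hη : 0 < η) :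
    ∃ δ > 0, ∀ s, 0 < s → s < δ →
      |g s| ≤ η * s ∧ |deriv g s| ≤ η ∧ |s * iteratedDeriv 2 g s| ≤ η := by
  have h0 := (h.isLittleO 0 (by norm_num)).bound hη
  have h1 := (h.isLittleO 1 (by norm_num)).bound hη
  have h2 := (h.isLittleO 2 (by norm_num)).bound hη
  obtain ⟨δ, hδ, H⟩ := mem_nhdsGT_iff_exists_Ioo_subset.1 ((h0.and h1).and h2)
  refine ⟨δ, hδ, fun s hs hs' => ?_⟩
  obtain ⟨⟨a0, a1⟩, a2⟩ := H ⟨hs, hs'⟩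
  simp only [iteratedDeriv_zero, iteratedDeriv_one, Real.norm_eq_abs] at a0 a1 a2
  norm_num at a0 a1 a2
  refine ⟨by rwa [abs_of_pos hs] at a0, a1, ?_⟩
  rw [abs_mul, abs_of_pos hs]
  rw [abs_of_pos hs, ← div_eq_mul_inv, le_div_iff₀ hs] at a2
  linarith

/-- Mean value inequality on [a, s] with a → 0⁺; only the limit of f at 0 enters, not its value or
derivative there. -/
theorem abs_le_mul_of_hasDerivAt {f f' : ℝ → ℝ} {S C : ℝ}
    (hf : ∀ s, 0 < s → s ≤ S → HasDerivAt f (f' s) s) (h0 : Tendsto f (𝓝[>] 0) (𝓝 0))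
    (hC : ∀ s, 0 < s → s ≤ S → |f' s| ≤ C) {s : ℝ} (hs : 0 < s) (hsS : s ≤ S) :
    |f s| ≤ C * s := by
  have h1 : ∀ᶠ a in 𝓝[>] (0 : ℝ), |f s - f a| ≤ C * s := by
    filter_upwards [Ioo_mem_nhdsGT hs] with a ha
    have := (convex_Icc a s).norm_image_sub_le_of_norm_hasDerivWithin_le (f := f) (f' := f')
      (fun x hx => (hf x (ha.1.trans_le hx.1) (hx.2.trans hsS)).hasDerivWithinAt)
      (fun x hx => hC x (ha.1.trans_le hx.1) (hx.2.trans hsS))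
      (left_mem_Icc.2 ha.2.le) (right_mem_Icc.2 ha.2.le)
    rw [Real.norm_eq_abs, Real.norm_eq_abs, abs_of_pos (sub_pos.2 ha.2)] at this
    have hC0 : 0 ≤ C := (abs_nonneg _).trans (hC s hs hsS)
    nlinarith [ha.1]
  have h2 : Tendsto (fun a => |f s - f a|) (𝓝[>] 0) (𝓝 |f s - 0|) := (h0.const_sub (f s)).abs
  rw [sub_zero] at h2
  exact le_of_tendsto h2 h1

theorem HypothesisH1.hasDerivAt_primitive (h : HypothesisH1 g) {s : ℝ} (hs : 0 < s) :
    HasDerivAt (primitive g) (g s) s := by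
  refine intervalIntegral.integral_hasDerivAt_right ?_ ?_ ?_
  · refine (h.continuousOn.mono ?_).intervalIntegrable
    rw [uIcc_of_le hs.le]
    exact Icc_subset_Ici_self
  · exact ContinuousOn.stronglyMeasurableAtFilter isOpen_Ioi
      (h.continuousOn.mono Ioi_subset_Ici_self) s hs
  · exact (h.hasDerivAt hs).continuousAt

theorem abs_primitive_le {η δ s : ℝ} (hδ : ∀ s, 0 < s → s < δ → |g s| ≤ η * s) (hη : 0 ≤ η)
    (hs : 0 < s) (hsδ : s < δ) : |primitive g s| ≤ η * s ^ 2 := by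
  have := intervalIntegral.norm_integral_le_of_norm_le_const (f := g) (a := 0) (b := s)
    (C := η * s) fun x hx => by
      rw [uIoc_of_le hs.le] at hx
      refine (hδ x hx.1 (hx.2.trans_lt hsδ)).trans ?_
      have := hx.2
      gcongr
  rw [sub_zero, abs_of_pos hs] at this
  refine this.trans_eq ?_
  ring

/-- The combinations of `g` that vanish for linear `g` are controlled by `s g''(s)`. -/
theorem HypothesisH1.abs_combinations_le (h : HypothesisH1 g) {S C : ℝ}
    (hC : ∀ s, 0 < s → s ≤ S → |s * iteratedDeriv 2 g s| ≤ C) {s : ℝ} (hs : 0 < s) (hsS : s ≤ S) :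
    |s * deriv g s - g s| ≤ C * s ∧ |2 * primitive g s - s * g s| ≤ C * s ^ 2 := by
  obtain ⟨δ, hδ, H⟩ := h.exists_bounds one_pos
  have hsq : Tendsto (fun s : ℝ => 3 * s) (𝓝[>] 0) (𝓝 0) := by
    have : Tendsto (fun s : ℝ => 3 * s) (𝓝 0) (𝓝 (3 * 0)) := (continuous_const_mul 3).tendsto 0
    rw [mul_zero] at this
    exact this.mono_left nhdsWithin_le_nhds
  have h1 : ∀ s, 0 < s → s ≤ S → |s * deriv g s - g s| ≤ C * s := fun s hs hsS => by
    refine abs_le_mul_of_hasDerivAt (f := fun s => s * deriv g s - g s) (S := S)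
      (f' := fun s => s * iteratedDeriv 2 g s) (fun s hs _ => ?_) ?_ hC hs hsS
    · refine (((hasDerivAt_id s).mul (h.hasDerivAt_deriv hs)).sub (h.hasDerivAt hs)).congr_deriv ?_
      simp
    · refine squeeze_zero_norm' ?_ hsq
      filter_upwards [Ioo_mem_nhdsGT hδ] with a ha
      obtain ⟨b0, b1, -⟩ := H a ha.1 ha.2
      rw [Real.norm_eq_abs]
      refine (abs_sub _ _).trans ?_
      rw [abs_mul, abs_of_pos ha.1]
      nlinarith [ha.1]
  refine ⟨h1 s hs hsS, ?_⟩
  -- The derivative of 2G - s g is minus the first combination, already bounded by C t ≤ C s on (0,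
  -- s].
  have h2 := abs_le_mul_of_hasDerivAt (f := fun s => 2 * primitive g s - s * g s) (S := s)
      (f' := fun s => -(s * deriv g s - g s)) (C := C * s) (s := s) (fun t ht _ => ?_) ?_
      (fun t ht hts => ?_) hs le_rfl
  · rw [sq, ← mul_assoc]; exact h2
  · refine (((h.hasDerivAt_primitive ht).const_mul 2).sub
      ((hasDerivAt_id t).mul (h.hasDerivAt ht))).congr_deriv ?_
    simp
    ring
  · refine squeeze_zero_norm' ?_ hsq
    filter_upwards [Ioo_mem_nhdsGT (lt_min hδ one_pos)] with a ha
    have haδ := ha.2.trans_le (min_le_left _ _)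
    have ha1 := ha.2.trans_le (min_le_right _ _)
    have c1 := abs_primitive_le (fun s hs hs' => (H s hs hs').1) one_pos.le ha.1 haδ
    obtain ⟨b0, -, -⟩ := H a ha.1 haδ
    rw [Real.norm_eq_abs]
    refine (abs_sub _ _).trans ?_
    rw [abs_mul, abs_mul, abs_of_pos ha.1, abs_two]
    nlinarith [ha.1, abs_nonneg (g a)]
  · rw [abs_neg]
    refine (h1 t ht (hts.trans hsS)).trans ?_
    have : 0 ≤ C := (abs_nonneg _).trans (hC s hs hsS)
    gcongr

/-- The a priori bound `η` makes the set bounded above, without which `sSup` would carry no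
information. -/
theorem abs_le_smallness {ω η : ℝ}
    (hη : ∀ s, 0 < s → s ≤ 3 * ω → |s * iteratedDeriv 2 g s| ≤ η) {s : ℝ} (hs : 0 < s)
    (hsω : s ≤ 3 * ω) : |s * iteratedDeriv 2 g s| ≤ smallness g ω := by
  refine le_csSup ⟨max η 0, ?_⟩ ⟨s, ⟨hs.le, hsω⟩, rfl⟩
  rintro _ ⟨t, ht, rfl⟩
  rcases ht.1.eq_or_lt with h0 | h0
  · simp [← h0]
  · exact (hη t h0 ht.2).trans (le_max_left _ _)

theorem smallness_le {ω η : ℝ} (hη0 : 0 ≤ η)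
    (hη : ∀ s, 0 < s → s ≤ 3 * ω → |s * iteratedDeriv 2 g s| ≤ η) : smallness g ω ≤ η := by
  refine Real.sSup_le ?_ hη0
  rintro _ ⟨t, ht, rfl⟩
  rcases ht.1.eq_or_lt with h0 | h0
  · simpa [← h0] using hη0
  · exact hη t h0 ht.2

theorem smallness_nonneg (g : ℝ → ℝ) (ω : ℝ) : 0 ≤ smallness g ω := by
  refine Real.sSup_nonneg ?_
  rintro _ ⟨t, -, rfl⟩
  exact abs_nonneg _

/-! ### Positivity, decay, energy and amplitude of solitary waves -/

namespace IsSolitaryWave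

variable {ω : ℝ} {φ : ℝ → ℝ}

theorem hasDerivAt (h : IsSolitaryWave g ω φ) (x : ℝ) : HasDerivAt φ (deriv φ x) x :=
  (h.contDiff.differentiable (by norm_num)).differentiableAt.hasDerivAt

theorem hasDerivAt_deriv (h : IsSolitaryWave g ω φ) (x : ℝ) :
    HasDerivAt (deriv φ) (ω * φ x - φ x ^ 3 + φ x * g (φ x ^ 2)) x := by
  rw [← h.equation]
  have h1 : ContDiff ℝ 1 (deriv φ) :=
    (contDiff_succ_iff_deriv (n := 1)).1 (h.contDiff.of_le (by norm_num)) |>.2.2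
  exact (h1.differentiable (by norm_num)).differentiableAt.hasDerivAt

theorem continuous_deriv (h : IsSolitaryWave g ω φ) : Continuous (deriv φ) :=
  continuous_of_hasDerivAt h.hasDerivAt_deriv

theorem sq_integrable (h : IsSolitaryWave g ω φ) : Integrable fun x => φ x ^ 2 :=
  h.memH1.1.integrable_sq

theorem deriv_sq_integrable (h : IsSolitaryWave g ω φ) : Integrable fun x => deriv φ x ^ 2 := by
  obtain ⟨-, φ', hw, hφ'⟩ := h.memH1
  exact (hφ'.ae_eq (hw.ae_eq_of_hasDerivAt h.hasDerivAt h.continuous_deriv)).integrable_sq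

/-- A zero of φ ≥ 0 is a minimum, so φ' vanishes there too. As φ solves u'' = q u with q continuous,
it would vanish identically. -/
theorem pos (h : IsSolitaryWave g ω φ) (hg : ContinuousOn g (Ici 0)) (x : ℝ) : 0 < φ x := by
  refine (h.nonneg x).lt_of_ne' fun h0 => ?_
  have h1 : deriv φ x = 0 := IsLocalMin.deriv_eq_zero
    (Eventually.of_forall fun y => by rw [h0]; exact h.nonneg y)
  obtain ⟨y, hy⟩ := h.nontrivial
  refine hy (eq_zero_of_linear_ode (q := fun x => ω - φ x ^ 2 + g (φ x ^ 2)) ?_ h.hasDerivAt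
    (fun x => (h.hasDerivAt_deriv x).congr_deriv (by ring)) h0 h1 y)
  have hφ := h.contDiff.continuous
  have : Continuous fun x => g (φ x ^ 2) :=
    hg.comp_continuous (by fun_prop) fun x => mem_Ici.2 (sq_nonneg _)
  exact (continuous_const.sub (hφ.pow 2)).add this

theorem sq_hasDerivAt (h : IsSolitaryWave g ω φ) (x : ℝ) :
    HasDerivAt (fun x => φ x ^ 2) (2 * (φ x * deriv φ x)) x := by
  refine ((h.hasDerivAt x).pow 2).congr_deriv ?_
  push_cast
  ring

theorem mul_deriv_integrable (h : IsSolitaryWave g ω φ) :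
    Integrable fun x => 2 * (φ x * deriv φ x) := by
  have h1 := h.contDiff.continuous
  have h2 := h.continuous_deriv
  refine (h.sq_integrable.add h.deriv_sq_integrable).mono' (by fun_prop) (ae_of_all _ fun x => ?_)
  rw [Real.norm_eq_abs, abs_le]
  simp only [Pi.add_apply]
  constructor <;> nlinarith [sq_nonneg (φ x + deriv φ x), sq_nonneg (φ x - deriv φ x)]

theorem tendsto_zero_of_sq (h : IsSolitaryWave g ω φ) {F : Filter ℝ}
    (hF : Tendsto (fun x => φ x ^ 2) F (𝓝 0)) : Tendsto φ F (𝓝 0) := by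
  have := (Real.continuous_sqrt.tendsto 0).comp hF
  rw [Real.sqrt_zero] at this
  exact this.congr fun x => Real.sqrt_sq (h.nonneg x)

theorem tendsto_atTop (h : IsSolitaryWave g ω φ) : Tendsto φ atTop (𝓝 0) :=
  h.tendsto_zero_of_sq (tendsto_zero_of_hasDerivAt_of_integrableOn_Ioi (a := 0)
    (fun x _ => h.sq_hasDerivAt x) h.mul_deriv_integrable.integrableOn
    h.sq_integrable.integrableOn)

theorem tendsto_atBot (h : IsSolitaryWave g ω φ) : Tendsto φ atBot (𝓝 0) :=
  h.tendsto_zero_of_sq (tendsto_zero_of_hasDerivAt_of_integrableOn_Iic (a := 0)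
    (fun x _ => h.sq_hasDerivAt x) h.mul_deriv_integrable.integrableOn
    h.sq_integrable.integrableOn)

theorem deriv_zero (h : IsSolitaryWave g ω φ) : deriv φ 0 = 0 := by
  have h1 : HasDerivAt (fun x => φ (-x)) (-deriv φ 0) 0 := by
    have h2 : HasDerivAt φ (deriv φ 0) (-0) := by rw [neg_zero]; exact h.hasDerivAt 0
    refine (h2.comp 0 (hasDerivAt_neg 0)).congr_deriv ?_
    ring
  have h3 : (fun x => φ (-x)) = φ := funext h.even
  rw [h3] at h1
  have := h1.unique (h.hasDerivAt 0)
  linarith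

/-- Conservation of energy. -/
theorem deriv_sq (h : IsSolitaryWave g ω φ) (hg : HypothesisH1 g) (x : ℝ) :
    deriv φ x ^ 2 = ω * φ x ^ 2 - φ x ^ 4 / 2 + primitive g (φ x ^ 2) := by
  have hpos := h.pos hg.continuousOn
  have hd : ∀ x, HasDerivAt (fun x => deriv φ x ^ 2 -
      (ω * φ x ^ 2 - φ x ^ 4 / 2 + primitive g (φ x ^ 2))) 0 x := fun x => by
    have h1 := (hg.hasDerivAt_primitive (pow_pos (hpos x) 2)).comp x (h.sq_hasDerivAt x)
    refine (((h.hasDerivAt_deriv x).pow 2).sub ((((h.sq_hasDerivAt x).const_mul ω).sub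
      (((h.hasDerivAt x).pow 4).div_const 2)).add h1)).congr_deriv ?_
    push_cast
    ring
  have hconst : ∀ y, deriv φ y ^ 2 - (ω * φ y ^ 2 - φ y ^ 4 / 2 + primitive g (φ y ^ 2)) =
      deriv φ x ^ 2 - (ω * φ x ^ 2 - φ x ^ 4 / 2 + primitive g (φ x ^ 2)) := fun y =>
    is_const_of_deriv_eq_zero (fun x => (hd x).differentiableAt) (fun x => (hd x).deriv) y x
  set E := deriv φ x ^ 2 - (ω * φ x ^ 2 - φ x ^ 4 / 2 + primitive g (φ x ^ 2)) with hE
  have ht := h.tendsto_atTop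
  have hG : Tendsto (fun x => primitive g (φ x ^ 2)) atTop (𝓝 0) := by
    obtain ⟨δ, hδ, H⟩ := hg.exists_bounds one_pos
    have h2 : Tendsto (fun x => φ x ^ 2) atTop (𝓝 0) := by simpa using ht.pow 2
    refine squeeze_zero_norm' (a := fun x => 1 * (φ x ^ 2) ^ 2) ?_ (by
      simpa using (h2.pow 2))
    filter_upwards [h2.eventually_lt_const hδ] with y hy
    exact abs_primitive_le (fun s hs hs' => (H s hs hs').1) one_pos.le (pow_pos (hpos y) 2) hy
  have hlim : Tendsto (fun y => deriv φ y ^ 2) atTop (𝓝 E) := by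
    have := (((ht.pow 2).const_mul ω).sub ((ht.pow 4).div_const 2)).add hG |>.const_add E
    norm_num at this
    refine this.congr fun y => ?_
    rw [← hconst y]
    ring
  -- φ'² is integrable, so its limit E at infinity can only be 0.
  have hE0 : E = 0 := by
    refine IntegrableAtFilter.eq_zero_of_tendsto
      (h.deriv_sq_integrable.integrableAtFilter atTop) (fun s hs => ?_) hlim
    obtain ⟨b, hb⟩ := mem_atTop_sets.1 hs
    rw [← top_le_iff, ← Real.volume_Ici (a := b)]
    exact measure_mono hb
  linarith

/-- The amplitude of a solitary wave is comparable to `√ω`. -/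
theorem sq_lt (h : IsSolitaryWave g ω φ) (hg : HypothesisH1 g) (hω : 0 < ω) {δ : ℝ}
    (hδ : ∀ s, 0 < s → s < δ → |g s| ≤ 1 / 20 * s) (hωδ : 3 * ω < δ) (x : ℝ) :
    φ x ^ 2 ≤ 20 / 9 * ω := by
  have hpos := h.pos hg.continuousOn
  -- With s = φ² < δ, energy gives 0 ≤ φ'² ≤ s(ω - 9s/20). Hence φ² takes no value strictly between
  -- 20ω/9 and δ, in particular not 3ω, and cannot cross this gap.
  have small : ∀ y, φ y ^ 2 < δ → φ y ^ 2 ≤ 20 / 9 * ω := fun y hy => by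
    have h1 := h.deriv_sq hg y
    have hs := pow_pos (hpos y) 2
    have h2 := (abs_le.1 (abs_primitive_le hδ (by norm_num) hs hy)).2
    have h3 := sq_nonneg (deriv φ y)
    have h4 : 0 ≤ φ y ^ 2 * (ω - 9 / 20 * φ y ^ 2) := by nlinarith
    have := nonneg_of_mul_nonneg_right h4 hs
    linarith
  by_contra hx
  have hxδ : δ ≤ φ x ^ 2 := le_of_not_gt fun hlt => hx (small x hlt)
  have h2 : Tendsto (fun x => φ x ^ 2) atTop (𝓝 0) := by simpa using h.tendsto_atTop.pow 2
  obtain ⟨y, hy⟩ := (h2.eventually_lt_const (by linarith : (0 : ℝ) < 3 * ω)).exists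
  have hc : Continuous fun x => φ x ^ 2 := h.contDiff.continuous.pow 2
  obtain ⟨z, hz⟩ := mem_range_of_exists_le_of_exists_ge hc ⟨y, hy.le⟩
    ⟨x, (hωδ.le.trans hxδ)⟩
  have := small z (by simp only at hz; linarith)
  simp only at hz
  linarith

end IsSolitaryWave

end NLS

/-! ### Solitary waves as profiles, and regularity of resonances -/

namespace NLS

variable {g : ℝ → ℝ}

/-- `φ'' / φ` for a solitary wave `φ`. -/
def waveN (g : ℝ → ℝ) (ω : ℝ) (φ : ℝ → ℝ) (x : ℝ) : ℝ := ω - φ x ^ 2 + g (φ x ^ 2)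

/-- Half the difference of the potentials of `L₊` and `L₋`. -/
noncomputable def waveL (g : ℝ → ℝ) (φ : ℝ → ℝ) (x : ℝ) : ℝ := φ x ^ 2 * (deriv g (φ x ^ 2) - 1)

/-- The logarithmic derivative of a solitary wave. -/
noncomputable def waveP (φ : ℝ → ℝ) (x : ℝ) : ℝ := deriv φ x / φ x

namespace IsSolitaryWave

variable {ω : ℝ} {φ : ℝ → ℝ}

theorem waveP_mul (h : IsSolitaryWave g ω φ) (hg : HypothesisH1 g) (x : ℝ) :
    waveP φ x * φ x = deriv φ x :=
  div_mul_cancel₀ _ (h.pos hg.continuousOn x).ne'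

theorem waveP_sq (h : IsSolitaryWave g ω φ) (hg : HypothesisH1 g) (x : ℝ) :
    waveP φ x ^ 2 = ω - φ x ^ 2 / 2 + primitive g (φ x ^ 2) / φ x ^ 2 := by
  have h0 := (h.pos hg.continuousOn x).ne'
  rw [waveP, div_pow, h.deriv_sq hg]
  field_simp

theorem hasDerivAt_sq (h : IsSolitaryWave g ω φ) (hg : HypothesisH1 g) (x : ℝ) :
    HasDerivAt (fun x => φ x ^ 2) (2 * waveP φ x * φ x ^ 2) x := by
  refine (h.sq_hasDerivAt x).congr_deriv ?_
  rw [← h.waveP_mul hg]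
  ring

theorem hasDerivAt_waveP (h : IsSolitaryWave g ω φ) (hg : HypothesisH1 g) (x : ℝ) :
    HasDerivAt (waveP φ) (waveN g ω φ x - waveP φ x ^ 2) x := by
  have h0 := (h.pos hg.continuousOn x).ne'
  refine ((h.hasDerivAt_deriv x).div (h.hasDerivAt x) h0).congr_deriv ?_
  rw [waveN, waveP]
  field_simp

theorem hasDerivAt_waveN (h : IsSolitaryWave g ω φ) (hg : HypothesisH1 g) (x : ℝ) :
    HasDerivAt (waveN g ω φ) (2 * waveP φ x * waveL g φ x) x := by
  have h1 := (hg.hasDerivAt (pow_pos (h.pos hg.continuousOn x) 2)).comp x (h.hasDerivAt_sq hg x)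
  refine (((h.hasDerivAt_sq hg x).const_sub ω).add h1).congr_deriv ?_
  rw [waveL]
  ring

theorem hasDerivAt_waveL (h : IsSolitaryWave g ω φ) (hg : HypothesisH1 g) (x : ℝ) :
    HasDerivAt (waveL g φ) (2 * waveP φ x * (waveL g φ x +
      φ x ^ 2 * (φ x ^ 2 * iteratedDeriv 2 g (φ x ^ 2)))) x := by
  have h1 := (hg.hasDerivAt_deriv (pow_pos (h.pos hg.continuousOn x) 2)).comp x
    (h.hasDerivAt_sq hg x)
  refine ((h.hasDerivAt_sq hg x).mul (h1.sub_const 1)).congr_deriv ?_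
  rw [waveL]
  simp only [Function.comp_apply]
  ring

/-- With s = φ², b = (s g' - g) + 2(2G/s - g) and q = (s g' - g) + (2G/s - g), both parentheses
being at most εs. The same combinations, together with s² g'' and |p| ≤ √ω, bound the derivatives of
b and q. -/
theorem isNearCubic (h : IsSolitaryWave g ω φ) (hg : HypothesisH1 g) (hω : 0 < ω) {δ ε : ℝ}
    (hδ : ∀ s, 0 < s → s < δ → |g s| ≤ 1 / 1000 * s ∧ |deriv g s| ≤ 1 / 1000)
    (hωδ : 3 * ω < δ) (hε0 : 0 < ε) (hε1 : ε ≤ 1 / 1000)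
    (hε : ∀ s, 0 < s → s ≤ 3 * ω → |s * iteratedDeriv 2 g s| ≤ ε)
    (hI : 20000 * ε ^ 2 * √ω ≤ ∫ x, (-3 * g (φ x ^ 2) + φ x ^ 2 * deriv g (φ x ^ 2)
      + 4 * (primitive g (φ x ^ 2) / φ x ^ 2))) :
    IsNearCubic (√ω) ε φ (waveP φ) (waveN g ω φ) (waveL g φ)
      (fun x => waveP φ x * (8 * (waveN g ω φ x - waveP φ x ^ 2) - 4 * waveL g φ x +
        2 * φ x ^ 2 * (φ x ^ 2 * iteratedDeriv 2 g (φ x ^ 2))))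
      (fun x => waveP φ x * (4 * (waveN g ω φ x - waveP φ x ^ 2) - 2 * waveL g φ x +
        2 * φ x ^ 2 * (φ x ^ 2 * iteratedDeriv 2 g (φ x ^ 2)))) := by
  have hpos := h.pos hg.continuousOn
  have hs0 : ∀ x, 0 < φ x ^ 2 := fun x => pow_pos (hpos x) 2
  have hs : ∀ x, φ x ^ 2 ≤ 20 / 9 * ω := h.sq_lt hg hω
    (fun s hs hs' => (hδ s hs hs').1.trans (by linarith)) hωδ
  have hk : 0 < √ω := Real.sqrt_pos.2 hω
  have hk2 : √ω ^ 2 = ω := Real.sq_sqrt hω.le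
  have hφk : ∀ x, φ x ≤ 2 * √ω := fun x => by
    refine le_of_sq_le_sq ?_ (by positivity)
    rw [mul_pow, hk2]
    linarith [hs x]
  have hsφ : ∀ x, φ x ^ 2 ≤ 2 * √ω * φ x := fun x => by
    rw [sq]
    exact mul_le_mul_of_nonneg_right (hφk x) (hpos x).le
  have hgs : ∀ x, |g (φ x ^ 2)| ≤ 1 / 1000 * φ x ^ 2 := fun x =>
    (hδ _ (hs0 x) (by linarith [hs x])).1
  have hgd : ∀ x, |deriv g (φ x ^ 2)| ≤ 1 / 1000 := fun x =>
    (hδ _ (hs0 x) (by linarith [hs x])).2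
  have hG : ∀ x, |primitive g (φ x ^ 2) / φ x ^ 2| ≤ 1 / 1000 * φ x ^ 2 := fun x => by
    rw [abs_div, abs_of_pos (hs0 x), div_le_iff₀ (hs0 x), mul_assoc, ← sq]
    exact abs_primitive_le (fun s h1 h2 => (hδ s h1 h2).1) (by norm_num) (hs0 x)
      (by linarith [hs x])
  have hc1 : ∀ x, |φ x ^ 2 * deriv g (φ x ^ 2) - g (φ x ^ 2)| ≤ ε * φ x ^ 2 := fun x =>
    (hg.abs_combinations_le hε (hs0 x) (by linarith [hs x])).1
  have hc2 : ∀ x, |2 * (primitive g (φ x ^ 2) / φ x ^ 2) - g (φ x ^ 2)| ≤ ε * φ x ^ 2 :=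
    fun x => by
      have h1 := (hg.abs_combinations_le hε (hs0 x) (by linarith [hs x])).2
      have e : 2 * (primitive g (φ x ^ 2) / φ x ^ 2) - g (φ x ^ 2) =
          (2 * primitive g (φ x ^ 2) - φ x ^ 2 * g (φ x ^ 2)) / φ x ^ 2 := by
        have := (hpos x).ne'
        field_simp
      rw [e, abs_div, abs_of_pos (hs0 x), div_le_iff₀ (hs0 x), mul_assoc, ← sq]
      exact h1
  have hg2 : ∀ x, |φ x ^ 2 * (φ x ^ 2 * iteratedDeriv 2 g (φ x ^ 2))| ≤ ε * φ x ^ 2 := fun x => by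
    rw [abs_mul, abs_of_pos (hs0 x), mul_comm ε]
    exact mul_le_mul_of_nonneg_left (hε _ (hs0 x) (by linarith [hs x])) (hs0 x).le
  have hl : ∀ x, |waveL g φ x| ≤ 2 * φ x ^ 2 := fun x => by
    have h1 := abs_le.1 (hgd x)
    rw [waveL, abs_mul, abs_of_pos (hs0 x), mul_comm]
    refine mul_le_mul_of_nonneg_right ?_ (hs0 x).le
    rw [abs_le]
    constructor <;> linarith
  have hnω : ∀ x, |waveN g ω φ x - ω| ≤ 2 * φ x ^ 2 := fun x => by
    have h1 := abs_le.1 (hgs x)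
    have := hs0 x
    rw [waveN, abs_le]
    constructor <;> linarith
  have hp2 := h.waveP_sq hg
  have hpω : ∀ x, waveP φ x ^ 2 ≤ ω := fun x => by
    have h1 := abs_le.1 (hG x)
    have := hs0 x
    rw [hp2]
    linarith
  have hpk : ∀ x, |waveP φ x| ≤ √ω := fun x => by
    refine abs_le_of_sq_le_sq ?_ hk.le
    rw [hk2]
    exact hpω x
  have hd1 : ∀ x, 2 / 5 * φ x ^ 2 ≤ waveP φ x ^ 2 - waveN g ω φ x := fun x => by
    have h1 := abs_le.1 (hG x)
    have h2 := abs_le.1 (hgs x)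
    have := hs0 x
    rw [hp2, waveN]
    linarith
  have hd2 : ∀ x, waveP φ x ^ 2 - waveN g ω φ x ≤ 3 / 5 * φ x ^ 2 := fun x => by
    have h1 := abs_le.1 (hG x)
    have h2 := abs_le.1 (hgs x)
    have := hs0 x
    rw [hp2, waveN]
    linarith
  have hb : ∀ x, 4 * waveP φ x ^ 2 - 3 * waveN g ω φ x + waveL g φ x - √ω ^ 2 =
      -3 * g (φ x ^ 2) + φ x ^ 2 * deriv g (φ x ^ 2)
        + 4 * (primitive g (φ x ^ 2) / φ x ^ 2) := fun x => by
    rw [hp2, waveN, waveL, hk2]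
    ring
  have hp0 : waveP φ 0 = 0 := by rw [waveP, h.deriv_zero, zero_div]
  have hpn : ∀ x, |waveP φ x| ≤ 10 * ω + 10 * √ω := fun x => by linarith [hpk x]
  have hdb : ∀ x {a : ℝ}, |a| ≤ 10 * ε * φ x ^ 2 →
      |waveP φ x * a| ≤ 10 * ε * √ω * φ x ^ 2 := fun x a ha => by
    rw [abs_mul]
    refine (mul_le_mul (hpk x) ha (abs_nonneg _) hk.le).trans_eq ?_
    ring
  refine
    { pos := hpos
      hasDerivAt := fun x => by rw [h.waveP_mul hg]; exact h.hasDerivAt x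
      hasDerivAt_p := h.hasDerivAt_waveP hg
      hasDerivAt_n := h.hasDerivAt_waveN hg
      continuous_l := continuous_of_hasDerivAt (h.hasDerivAt_waveL hg)
      p_zero := hp0
      n_zero := fun hn => by
        have h1 := hd1 0
        rw [hp0, hn] at h1
        have := hs0 0
        linarith
      sq_integrable := h.sq_integrable
      bound := ⟨10 * ω + 10 * √ω, fun x => ⟨hpn x, ?_, ?_, ?_, ?_, ?_, ?_⟩⟩
      k_pos := hk
      ε_pos := hε0
      ε_le := hε1
      even := h.even
      tendsto_atTop := h.tendsto_atTop
      tendsto_atBot := h.tendsto_atBot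
      sq_le := fun x => by rw [hk2]; linarith [hs x]
      le_deriv := hd1
      deriv_le := hd2
      p_sq_le := fun x => by rw [hk2]; exact hpω x
      le_p_sq := fun x => ?_
      abs_b := fun x => ?_
      abs_q := fun x => ?_
      hasDerivAt_b := fun x => ?_
      hasDerivAt_q := fun x => ?_
      abs_b₁ := fun x => hdb x ?_
      abs_q₁ := fun x => hdb x ?_
      le_integral := ?_ }
  · have := abs_le.1 (hnω x)
    have := hs x
    rw [abs_le]
    constructor <;> linarith
  · linarith [hl x, hs x]
  · rw [hk2]
    have := mul_pos hω (hpos x)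
    have := mul_pos hk (hpos x)
    linarith [hnω x, hsφ x]
  · have := mul_pos hω (hpos x)
    have := mul_pos hk (hpos x)
    rw [abs_sub_comm, abs_of_nonneg (le_trans (by positivity) (hd1 x))]
    linarith [hd2 x, hsφ x]
  · have := mul_pos hω (hpos x)
    have := mul_pos hk (hpos x)
    linarith [hl x, hsφ x]
  · linarith [hφk x]
  · have h1 := abs_le.1 (hG x)
    have := hs0 x
    rw [hp2, hk2]
    linarith
  · rw [hb]
    have h1 := abs_le.1 (hc1 x)
    have h2 := abs_le.1 (hc2 x)
    rw [abs_le]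
    constructor <;> linarith
  · rw [hp2, waveN, waveL]
    have h1 := abs_le.1 (hc1 x)
    have h2 := abs_le.1 (hc2 x)
    have := mul_pos hε0 (hs0 x)
    rw [abs_le]
    constructor <;> linarith
  · refine ((((((h.hasDerivAt_waveP hg x).pow 2).const_mul 4).sub
      ((h.hasDerivAt_waveN hg x).const_mul 3)).add (h.hasDerivAt_waveL hg x)).sub_const
      (√ω ^ 2)).congr_deriv ?_
    push_cast
    ring
  · refine (((((h.hasDerivAt_waveP hg x).pow 2).const_mul 2).sub
      ((h.hasDerivAt_waveN hg x).const_mul 2)).add (h.hasDerivAt_waveL hg x)).congr_deriv ?_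
    push_cast
    ring
  · rw [hp2, waveN, waveL]
    have h1 := abs_le.1 (hc1 x)
    have h2 := abs_le.1 (hc2 x)
    have h3 := abs_le.1 (hg2 x)
    rw [abs_le]
    constructor <;> linarith
  · rw [hp2, waveN, waveL]
    have h1 := abs_le.1 (hc1 x)
    have h2 := abs_le.1 (hc2 x)
    have h3 := abs_le.1 (hg2 x)
    have := mul_pos hε0 (hs0 x)
    rw [abs_le]
    constructor <;> linarith
  · simp only [hb]
    exact hI

end IsSolitaryWave

/-! ### From weak to classical resonances -/

theorem exists_norm_le_of_memLp_top {f u : ℝ → ℂ} (hf : MemLp f ⊤ volume) (hu : Continuous u)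
    (h : f =ᵐ[volume] u) : ∃ C, ∀ x, ‖u x‖ ≤ C := by
  have hlt : eLpNormEssSup f volume ≠ ⊤ := by
    rw [← eLpNorm_exponent_top]
    exact hf.2.ne
  set C := (eLpNormEssSup f volume).toReal
  refine ⟨C, ?_⟩
  have h1 : ∀ᵐ x, ‖u x‖ ≤ C := by
    filter_upwards [ae_le_eLpNormEssSup (f := f) (μ := volume), h] with x h1 h2
    rw [← h2, ← toReal_enorm]
    exact ENNReal.toReal_mono hlt h1
  -- A closed condition valid almost everywhere holds on a dense set, hence everywhere.
  have h2 := Measure.dense_of_ae h1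
  have h3 : IsClosed {x | ‖u x‖ ≤ C} := isClosed_le hu.norm continuous_const
  have h4 := h2.closure_eq
  rw [h3.closure_eq] at h4
  exact fun x => (h4.symm ▸ mem_univ x : x ∈ {x | ‖u x‖ ≤ C})

/-- Regularity of weak solutions of `u'' = r`. -/
theorem classical_of_weak {f f₁ f₂ u r : ℝ → ℂ} (hf : HasWeakDeriv f f₁) (hf₁ : HasWeakDeriv f₁ f₂)
    (hu : ∀ w : ℝ → ℂ, Continuous w → f₁ =ᵐ[volume] w → ∀ x, HasDerivAt u (w x) x)
    (hr : Continuous r) (hf₂ : f₂ =ᵐ[volume] r)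
    (hL : ∃ X₁ : ℝ → ℂ, HasWeakDeriv f X₁ ∧ MemH1 X₁) :
    ∃ u₁ : ℝ → ℂ, (∀ x, HasDerivAt u (u₁ x) x) ∧ (∀ x, HasDerivAt u₁ (r x) x) ∧
      MemLp u₁ 2 volume ∧ MemLp r 2 volume := by
  obtain ⟨u₁, hu₁c, hu₁, hu₁d⟩ := hf₁.exists_continuous
  obtain ⟨X₁, hX₁, hL1, X₂, hX₂, hL2⟩ := hL
  have e1 : X₁ =ᵐ[volume] u₁ := (hX₁.ae_unique hf).trans hu₁
  have e2 : X₂ =ᵐ[volume] r :=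
    ((hX₂.congr_ae e1).ae_unique (hf₁.congr_ae hu₁)).trans hf₂
  exact ⟨u₁, hu u₁ hu₁c hu₁, hu₁d r hr hf₂, hL1.ae_eq e1, hL2.ae_eq e2⟩

theorem IsResonance.exists_classical {ω : ℝ} {X Y : ℝ → ℂ} {lam : ℂ}
    (h : IsResonance g ω X Y lam) {n l : ℝ → ℝ} (hn : Continuous n) (hl : Continuous l)
    (hm : potentialMinus g ω = n) (hp : potentialPlus g ω = fun x => n x + 2 * l x) :
    ∃ u u₁ v v₁ : ℝ → ℂ, X =ᵐ[volume] u ∧ Y =ᵐ[volume] v ∧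
      IsClassicalResonance n l lam u u₁ v v₁ := by
  obtain ⟨A₁, A₂, hA, hA₁, hA₂⟩ := h.eq_minus
  obtain ⟨B₁, B₂, hB, hB₁, hB₂⟩ := h.eq_plus
  obtain ⟨u, huc, hu, hud⟩ := hA.exists_continuous
  obtain ⟨v, hvc, hv, hvd⟩ := hB.exists_continuous
  obtain ⟨Cu, hCu⟩ := exists_norm_le_of_memLp_top h.memLp_left huc hu
  obtain ⟨Cv, hCv⟩ := exists_norm_le_of_memLp_top h.memLp_right hvc hv
  obtain ⟨u₁, hu₁, hu₂, hu₁i, hu₂i⟩ := classical_of_weak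
    (r := fun x => n x * u x - lam * v x) hA hA₁ hud (by fun_prop) (by
      filter_upwards [hA₂, hu, hv] with x h1 h2 h3
      rw [hm, h2, h3] at h1
      linear_combination -h1) h.deriv_left
  obtain ⟨v₁, hv₁, hv₂, hv₁i, hv₂i⟩ := classical_of_weak
    (r := fun x => (n x + 2 * l x) * v x - lam * u x) hB hB₁ hvd (by fun_prop) (by
      filter_upwards [hB₂, hu, hv] with x h1 h2 h3
      rw [hp, h2, h3] at h1
      push_cast at h1
      linear_combination -h1) h.deriv_right
  exact ⟨u, u₁, v, v₁, hu, hv, hu₁, hv₁, hu₂, hv₂,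
    ⟨max Cu Cv, fun x => ⟨(hCu x).trans (le_max_left _ _), (hCv x).trans (le_max_right _ _)⟩⟩,
    hu₁i, hv₁i, hu₂i, hv₂i⟩

end NLS

theorem corollary2 (g : ℝ → ℝ) (hg₁ : NLS.HypothesisH1 g) (hg₂ : NLS.HypothesisH2 g) :
    ∃ ω₀ : ℝ, 0 < ω₀ ∧ ∀ ω : ℝ, 0 < ω → ω < ω₀ →
      ∀ (X Y : ℝ → ℂ) (lam : ℂ), NLS.IsResonance g ω X Y lam →
        (X =ᵐ[volume] 0 ∧ Y =ᵐ[volume] 0) ∨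
        (lam = 0 ∧
          (∃ c : ℂ, ∀ᵐ x, X x = c * (NLS.solitaryWave g ω x : ℂ)) ∧
          (∃ c : ℂ, ∀ᵐ x, Y x = c * ((deriv (NLS.solitaryWave g ω) x : ℝ) : ℂ))) := by
  obtain ⟨δ, hδ, H⟩ := hg₁.exists_bounds (η := 1 / 1000) (by norm_num)
  -- 20000 is chosen so that ι, having density I/(2k) against p² - n ≥ 2φ²/5, is at least 4000ε²φ².
  obtain ⟨ω₁, hω₁, H2⟩ := mem_nhdsGT_iff_exists_Ioo_subset.1
    (hg₂.eventually_ge_atTop 20000)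
  have hω₁' : 0 < ω₁ := hω₁
  refine ⟨min ω₁ (δ / 3), by positivity, fun ω hω hω' X Y lam hr => ?_⟩
  have hωδ : 3 * ω < δ := by linarith [hω'.trans_le (min_le_right _ _)]
  have hv := H2 ⟨hω, hω'.trans_le (min_le_left _ _)⟩
  simp only [mem_ofPred_eq] at hv
  set φ := NLS.solitaryWave g ω with hφ
  have hk : 0 < √ω := Real.sqrt_pos.2 hω
  have hw : NLS.IsSolitaryWave g ω φ := by
    by_cases hex : ∃ φ, NLS.IsSolitaryWave g ω φ
    · rw [hφ, NLS.solitaryWave, dif_pos hex]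
      exact hex.choose_spec
    · exfalso
      -- Without a wave the integrand is the constant -3 g 0 (as x / 0 = 0), and its integral over
      -- the whole line is 0 by convention; (H₂) would fail, so the wave exists.
      have h0 : φ = 0 := by rw [hφ, NLS.solitaryWave, dif_neg hex]
      rw [h0] at hv
      simp [Measure.real] at hv
      norm_num at hv
  -- If it were 0, the prefactor 1 / 0 = 0 would again annihilate the quantity in (H₂).
  have hε0 : 0 < NLS.smallness g ω := by
    refine (NLS.smallness_nonneg g ω).lt_of_ne' fun h0 => ?_
    rw [h0] at hv
    norm_num at hv
  have hη : ∀ s, 0 < s → s ≤ 3 * ω → |s * iteratedDeriv 2 g s| ≤ 1 / 1000 := fun s h1 h2 =>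
    (H s h1 (h2.trans_lt hωδ)).2.2
  have hnc := hw.isNearCubic hg₁ hω (fun s h1 h2 => ⟨(H s h1 h2).1, (H s h1 h2).2.1⟩) hωδ hε0
    (NLS.smallness_le (by norm_num) hη) (fun s => NLS.abs_le_smallness hη) (by
      rw [one_div, inv_mul_eq_div, le_div_iff₀ (by positivity)] at hv
      linarith)
  obtain ⟨β, ι, hrep⟩ := hnc.repulsiveCoefficients
  have hprof := hnc.toIsProfile
  obtain ⟨u, u₁, v, v₁, hu, hv', hcl⟩ := hr.exists_classical hprof.continuous_n
    hprof.continuous_l rfl (funext fun x => by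
      simp only [NLS.potentialPlus, NLS.waveN, NLS.waveL]
      ring)
  by_cases hlam : lam = 0
  · right
    subst hlam
    obtain ⟨⟨c, hc⟩, ⟨d, hd⟩⟩ := hcl.of_eq_zero hprof
    refine ⟨rfl, ⟨c, hu.mono fun x hx => by rw [hx, hc]⟩, ⟨d, hv'.mono fun x hx => ?_⟩⟩
    rw [hx, hd, hw.waveP_mul hg₁]
  · left
    have h0 := hcl.eq_zero hprof hrep hlam
    exact ⟨hu.mono fun x hx => by rw [hx, (h0 x).1]; rfl,
      hv'.mono fun x hx => by rw [hx, (h0 x).2]; rfl⟩
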